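/- Let $1/2<\sigma<1$ and $0<\delta\le\sigma$ be fixed. For $T>1$ and real $\beta$ put $$L_T(\beta):=\max_{t\in[T,2T]}\log|\zeta(\beta+it)|,$$ and let $d_k(n)$ be the number of ways of writing $n$ as an ordered product of $k$ positive integers. For a function $K(T)$, say that the asymptotic formula $$\frac1T\int_T^{2T}|\zeta(\sigma+it)|^{2k}\,dt=(1+o(1))\sum_{n=1}^\infty\frac{d_k(n)^2}{n^{2\sigma}}\qquad(T\to\infty)\tag{1.7}$$ holds for all positive integers $k\le K(T)$ if it holds uniformly in this range, i.e. for every $\varepsilon>0$ there is a $T_0$ such that for all real $T\ge T_0$ and all positive integers $k\le K(T)$ the two sides (without the factor $1+o(1)$) differ by at most $\varepsilon\sum_{n\ge1}d_k(n)^2n^{-2\sigma}$. (a) If (1.7) holds for all positive integers $k\le(\log T)^\delta$, then $L_T(\sigma)=O\big((\log T)^{1-\delta}\big)$ as $T\to\infty$. (b) Conversely, if there are constants $C,T_0$ such that $|L_T(\beta)|\le C(\log T)^{1-\delta}$ for all $T\ge T_0$ and all real $\beta\ge\sigma-1/\log\log T$, then there is a constant $c>0$ such that (1.7) holds for all positive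 integers $k\le c(\log T)^\delta/\log\log T$. -/

import Mathlib

open Set Filter Asymptotics

/-- The `k`-fold divisor function: the number of ways of writing `n ≥ 1` as an ordered product of
`k` positive integers (and `0` at `n = 0`), i.e. the `n`-th coefficient of the Dirichlet series of
`ζ(s) ^ k`, given as the `k`-fold Dirichlet convolution power of the constant function `1`. -/
def divisorFun (k n : ℕ) : ℕ :=
  (ArithmeticFunction.zeta ^ k : ArithmeticFunction ℕ) n

/-- The normalized moment `(1 / T) ∫_T^{2T} |ζ(σ + it)|^{2k} dt`. -/
noncomputable def zetaMoment (σ : ℝ) (k : ℕ) (T : ℝ) : ℝ :=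
  (1 / T) * ∫ t in T..(2 * T), ‖riemannZeta ((σ : ℂ) + (t : ℂ) * Complex.I)‖ ^ (2 * k)

/-- The Dirichlet series `∑_{n ≥ 1} d_k(n)^2 / n^{2σ}`; the term `n = 0` vanishes. -/
noncomputable def divisorSum (σ : ℝ) (k : ℕ) : ℝ :=
  ∑' n : ℕ, (divisorFun k n : ℝ) ^ 2 / (n : ℝ) ^ (2 * σ)

/-- The asymptotic `(1 / T) ∫_T^{2T} |ζ(σ + it)|^{2k} dt = (1 + o(1)) ∑_n d_k(n)^2 / n^{2σ}` as
`T → ∞`, with `o(1)` uniform over all positive integers `k ≤ K T`. -/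
def MomentAsymptoticUpTo (σ : ℝ) (K : ℝ → ℝ) : Prop :=
  ∀ ε : ℝ, 0 < ε → ∃ T₀ : ℝ, ∀ T : ℝ, T₀ ≤ T → ∀ k : ℕ, 1 ≤ k → (k : ℝ) ≤ K T →
    |zetaMoment σ k T - divisorSum σ k| ≤ ε * divisorSum σ k

/-- `L_T(σ) = max_{t ∈ [T, 2T]} log |ζ(σ + it)|`. At a zero of `ζ` the logarithm is `-∞`, which
never is the maximum, whereas `Real.log 0 = 0`; hence zeros are left out. -/
noncomputable def maxLogZeta (T σ : ℝ) : ℝ :=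
  sSup ((fun t : ℝ => Real.log ‖riemannZeta ((σ : ℂ) + (t : ℂ) * Complex.I)‖) ''
    {t : ℝ | t ∈ Icc T (2 * T) ∧ riemannZeta ((σ : ℂ) + (t : ℂ) * Complex.I) ≠ 0})

/-! Both directions rest on `divisorSum_le`: the sum of d_k(n)² n^{-2σ} is at most exp(A k^{1/σ}).
This is read off the Euler product. A prime below (2k)^{1/σ} contributes O(k p^{-σ}) to the
logarithm and a larger one O(k² p^{-2σ}); since 1/2 < σ < 1, both sums are O(k^{1/σ}).

(a) Since ζ'(σ+it) = O(t), a value |ζ| = m ≥ 1 persists as |ζ| ≥ m/2 on an interval of length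
1/(200T), so (m/2)^{2k} is at most 200 T² times the 2k-th moment (`pow_le_zetaMoment`). For k =
⌊(log T)^δ⌋ the condition δ ≤ σ keeps the moment below a fixed power of T, and a 2k-th root gives
log m = O((log T)/k). The lower bound for the maximum needs only the moment with k = 1.

(b) Put l = log T, L = log l, Y = l/L, η = 1/(2L). For a small multiple of l^δ/L as range of k, the
hypothesis gives |ζ|^k ≤ exp(Y/100) to the right of σ - η, for heights within log T of [T, 2T]. A
Perron integral with Gaussian weight, moved to Re w = -η (`norm_sub_perronAvg_le`), then replaces
ζ(σ+it)^k by a Dirichlet polynomial of length about T^{1/4} (`norm_zeta_pow_sub_dirichletPoly_le`).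
With X = T^{1/16} the shift saves X^{-η} = exp(-Y/32), which beats the bound for |ζ|^k. The mean
value theorem `abs_meanSquare_sub_le` evaluates the mean square of the polynomial by its diagonal.
The diagonal differs from `divisorSum σ k` by a tiny multiple of `divisorSum (σ - η) k`, which is
itself at most exp(Y/100) because k ≤ l^σ/L. Every error is O(exp(-Y/100)) uniformly in k, and it is
a relative error because `divisorSum` is at least 1. -/

open MeasureTheory Topology

/-! ### Polynomial growth of ζ and ζ' inside the critical strip -/

/-- The fractional part of `t`, cut off to `t > 1`. -/
noncomputable def fractTail (t : ℝ) : ℂ := (Ioi (1 : ℝ)).indicator (fun t => ((Int.fract t : ℝ) : ℂ)) t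

lemma norm_fractTail_le (t : ℝ) : ‖fractTail t‖ ≤ 1 := by
  unfold fractTail
  by_cases h : t ∈ Ioi (1 : ℝ)
  · rw [indicator_of_mem h, Complex.norm_real, Real.norm_of_nonneg (Int.fract_nonneg t)]
    exact (Int.fract_lt_one t).le
  · rw [indicator_of_notMem h]; simp

lemma measurable_fractTail : Measurable fractTail :=
  (Complex.measurable_ofReal.comp measurable_fract).indicator measurableSet_Ioi

lemma locallyIntegrable_fractTail : LocallyIntegrable fractTail := by
  refine (locallyIntegrable_const (1 : ℂ)).mono measurable_fractTail.aestronglyMeasurable ?_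
  exact Eventually.of_forall fun t => by simpa using norm_fractTail_le t

lemma fractTail_isBigO_top : fractTail =O[atTop] (fun t : ℝ => t ^ (-(0 : ℝ))) := by
  refine IsBigO.of_bound 1 (Eventually.of_forall fun t => ?_)
  simpa using norm_fractTail_le t

lemma fractTail_isBigO_zero (b : ℝ) : fractTail =O[𝓝[>] 0] (fun t : ℝ => t ^ (-b)) := by
  refine IsBigO.of_bound 1 ?_
  filter_upwards [Ioo_mem_nhdsGT (show (0 : ℝ) < 1 by norm_num)] with t ht
  have : fractTail t = 0 := by
    unfold fractTail
    rw [indicator_of_notMem]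
    simpa using ht.2.le
  rw [this]; simp

/-- Boundedness at infinity is what confines the transform to Re s < 0. Vanishing near 0 imposes no
condition, so any exponent below `s.re` serves as `b`. -/
lemma differentiableAt_mellin_fractTail {s : ℂ} (hs : s.re < 0) :
    DifferentiableAt ℂ (mellin fractTail) s :=
  mellin_differentiableAt_of_isBigO_rpow (a := 0) (b := s.re - 1)
    (locallyIntegrable_fractTail.locallyIntegrableOn _) fractTail_isBigO_top hs
    (fractTail_isBigO_zero _) (by linarith)

lemma mellin_fractTail_eq (s : ℂ) :
    mellin fractTail s = ∫ t in Ioi (1 : ℝ), (t : ℂ) ^ (s - 1) * ((Int.fract t : ℝ) : ℂ) := by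
  have h : ∀ t : ℝ, (t : ℂ) ^ (s - 1) • fractTail t =
      (Ioi (1 : ℝ)).indicator (fun t : ℝ => (t : ℂ) ^ (s - 1) * ((Int.fract t : ℝ) : ℂ)) t := by
    intro t
    unfold fractTail
    by_cases h : t ∈ Ioi (1 : ℝ)
    · simp only [indicator_of_mem h, smul_eq_mul]
    · simp only [indicator_of_notMem h, smul_zero]
  simp only [mellin, h]
  rw [setIntegral_indicator measurableSet_Ioi]
  congr 2
  ext x; simp only [mem_inter_iff, mem_Ioi]; constructor
  · exact fun h => h.2
  · exact fun h => ⟨by linarith, h⟩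

lemma norm_mellin_fractTail_le {s : ℂ} (hs : s.re < 0) :
    ‖mellin fractTail s‖ ≤ 1 / (-s.re) := by
  rw [mellin_fractTail_eq]
  have hi : IntegrableOn (fun t : ℝ => t ^ (s.re - 1)) (Ioi 1) :=
    integrableOn_Ioi_rpow_of_lt (by linarith) one_pos
  calc _ ≤ ∫ t in Ioi (1 : ℝ), t ^ (s.re - 1) := by
        refine norm_integral_le_of_norm_le hi ?_
        filter_upwards [ae_restrict_mem measurableSet_Ioi] with t ht
        have ht0 : (0 : ℝ) < t := lt_trans one_pos ht
        rw [norm_mul, Complex.norm_cpow_eq_rpow_re_of_pos ht0, Complex.norm_real,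
          Real.norm_of_nonneg (Int.fract_nonneg t)]
        simpa using mul_le_mul_of_nonneg_left (Int.fract_lt_one t).le
          (Real.rpow_nonneg ht0.le (s.re - 1))
    _ = 1 / (-s.re) := by
        rw [integral_Ioi_rpow_of_lt (by linarith) one_pos]
        rw [sub_add_cancel, Real.one_rpow, neg_div, ← div_neg]

/-- Partial summation gives ζ(s) = s ∫ ⌊t⌋ t^{-s-1} dt over t > 1; splitting ⌊t⌋ = t - {t} isolates
the pole in the first part. -/
lemma riemannZeta_eq_mellin_fractTail_of_one_lt_re {s : ℂ} (hs : 1 < s.re) :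
    riemannZeta s = s / (s - 1) - s * mellin fractTail (-s) := by
  have hone : (fun n : ℕ ↦ ∑ k ∈ Finset.Icc 1 n, ‖(1 : ℕ → ℂ) k‖) =O[atTop]
      fun n ↦ (n : ℝ) ^ (1 : ℝ) := by
    refine IsBigO.of_bound 1 (Eventually.of_forall fun n => ?_)
    simp
  have h1 := LSeries_eq_mul_integral' (1 : ℕ → ℂ) zero_le_one hs hone
  rw [LSeries_one_eq_riemannZeta hs] at h1
  have hi : IntegrableOn (fun t : ℝ => (t : ℂ) ^ (-s)) (Ioi 1) :=
    integrableOn_Ioi_cpow_of_lt (by simpa using by linarith) one_pos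
  have hi2 : IntegrableOn (fun t : ℝ => (t : ℂ) ^ (-s - 1) * ((Int.fract t : ℝ) : ℂ)) (Ioi 1) := by
    have : IntegrableOn (fun t : ℝ => (t : ℂ) ^ (-s - 1)) (Ioi 1) :=
      integrableOn_Ioi_cpow_of_lt (by simpa using by linarith) one_pos
    refine Integrable.mono this (this.aestronglyMeasurable.mul
      (Complex.measurable_ofReal.comp measurable_fract).aestronglyMeasurable) ?_
    refine Eventually.of_forall fun t => ?_
    rw [norm_mul, Complex.norm_real, Real.norm_of_nonneg (Int.fract_nonneg t)]
    exact mul_le_of_le_one_right (norm_nonneg _) (Int.fract_lt_one t).le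
  have h2 : ∫ t in Ioi (1 : ℝ), (∑ k ∈ Finset.Icc 1 ⌊t⌋₊, (1 : ℕ → ℂ) k) * (t : ℂ) ^ (-(s + 1)) =
      (∫ t in Ioi (1 : ℝ), (t : ℂ) ^ (-s)) -
        ∫ t in Ioi (1 : ℝ), (t : ℂ) ^ (-s - 1) * ((Int.fract t : ℝ) : ℂ) := by
    rw [← integral_sub hi hi2]
    refine setIntegral_congr_fun measurableSet_Ioi fun t ht => ?_
    have ht0 : (0 : ℝ) < t := lt_trans one_pos ht
    have e1 : (t : ℂ) ^ (-s) = (t : ℂ) ^ (-s - 1) * t := by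
      rw [Complex.cpow_sub _ _ (by exact_mod_cast ht0.ne'), Complex.cpow_one]
      have : (t : ℂ) ≠ 0 := by exact_mod_cast ht0.ne'
      field_simp
    have e2 : ((⌊t⌋₊ : ℝ) : ℂ) = (t : ℂ) - ((Int.fract t : ℝ) : ℂ) := by
      rw [← Complex.ofReal_sub, Int.self_sub_fract, natCast_floor_eq_intCast_floor ht0.le]
    simp only [Pi.one_apply, Finset.sum_const, Nat.card_Icc, add_tsub_cancel_right, nsmul_eq_mul,
      mul_one]
    rw [e1, show -(s + 1) = -s - 1 by ring]
    have e3 : ((⌊t⌋₊ : ℕ) : ℂ) = ((⌊t⌋₊ : ℝ) : ℂ) := by push_cast; rfl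
    rw [e3, e2]; ring
  rw [h2, ← mellin_fractTail_eq, integral_Ioi_cpow_of_lt (by simpa using by linarith) one_pos] at h1
  rw [h1]
  have hs1 : s - 1 ≠ 0 := by
    intro h; rw [sub_eq_zero] at h; rw [h] at hs; simp at hs
  have hs2 : -s + 1 ≠ 0 := by intro h; apply hs1; linear_combination -h
  rw [Complex.ofReal_one, Complex.one_cpow]
  field_simp
  ring

/-- Identity theorem on the half-plane Re s > 0. Multiplying by s - 1 turns ζ into the entire
function `riemannZeta₁`, so that the pole need not be removed from the domain. -/
lemma riemannZeta_eq_mellin_fractTail {s : ℂ} (hs : 0 < s.re) (hs1 : s ≠ 1) :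
    riemannZeta s = s / (s - 1) - s * mellin fractTail (-s) := by
  have hopen : IsOpen {z : ℂ | 0 < z.re} := isOpen_lt continuous_const Complex.continuous_re
  have hconv : Convex ℝ {z : ℂ | 0 < z.re} := convex_halfSpace_re_gt 0
  have hf : AnalyticOnNhd ℂ riemannZeta₁ {z : ℂ | 0 < z.re} :=
    differentiable_riemannZeta₁.differentiableOn.analyticOnNhd hopen
  have hg : AnalyticOnNhd ℂ (fun z => z - z * (z - 1) * mellin fractTail (-z))
      {z : ℂ | 0 < z.re} := by
    refine DifferentiableOn.analyticOnNhd (fun z hz => ?_) hopen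
    have h1 : DifferentiableAt ℂ (fun z : ℂ => mellin fractTail (-z)) z :=
      DifferentiableAt.fun_comp' (f := fun z : ℂ => -z) (g := mellin fractTail) z
        (differentiableAt_mellin_fractTail (by simpa using hz)) differentiableAt_id.neg
    exact DifferentiableAt.differentiableWithinAt (by fun_prop)
  have heq : EqOn riemannZeta₁ (fun z => z - z * (z - 1) * mellin fractTail (-z))
      {z : ℂ | 0 < z.re} := by
    refine hf.eqOn_of_preconnected_of_eventuallyEq hg hconv.isPreconnected
      (z₀ := 2) (by simp) ?_
    have : {z : ℂ | 1 < z.re} ∈ 𝓝 (2 : ℂ) :=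
      (isOpen_lt continuous_const Complex.continuous_re).mem_nhds (by simp)
    filter_upwards [this] with z hz
    have hz1 : z ≠ 1 := by rintro rfl; simp at hz
    have h := riemannZeta_eq_mellin_fractTail_of_one_lt_re hz
    rw [riemannZeta_eq_inv_sub_mul hz1] at h
    have : z - 1 ≠ 0 := sub_ne_zero.mpr hz1
    field_simp at h
    linear_combination h
  have h := heq hs
  rw [riemannZeta_eq_inv_sub_mul hs1, h]
  have : s - 1 ≠ 0 := sub_ne_zero.mpr hs1
  field_simp

/-- A polynomial bound for `ζ` to the right of `Re s = 1/4`, away from the real axis. -/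
lemma norm_riemannZeta_le {s : ℂ} (hs : 1 / 4 ≤ s.re) (him : 1 ≤ |s.im|) :
    ‖riemannZeta s‖ ≤ 5 * ‖s‖ := by
  have hs1 : s ≠ 1 := by rintro rfl; norm_num at him
  have h1 : 1 ≤ ‖s - 1‖ := by
    refine him.trans ?_
    simpa using Complex.abs_im_le_norm (s - 1)
  have h2 := norm_mellin_fractTail_le (s := -s) (by simpa using by linarith)
  have h3 : ‖mellin fractTail (-s)‖ ≤ 4 := by
    refine h2.trans ?_
    rw [Complex.neg_re, neg_neg, div_le_iff₀ (by linarith)]; linarith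
  rw [riemannZeta_eq_mellin_fractTail (by linarith) hs1]
  calc _ ≤ ‖s / (s - 1)‖ + ‖s * mellin fractTail (-s)‖ := norm_sub_le _ _
    _ ≤ ‖s‖ + ‖s‖ * 4 := by
        rw [norm_div, norm_mul]
        gcongr
        exact div_le_self (norm_nonneg _) h1
    _ = 5 * ‖s‖ := by ring

/-- A bound for the derivative of `ζ` on the line `Re s = σ`. -/
lemma norm_deriv_riemannZeta_le {σ t : ℝ} (hσ : 1 / 2 ≤ σ) (hσ1 : σ ≤ 1) (ht : 2 ≤ t) :
    ‖deriv riemannZeta (σ + t * Complex.I)‖ ≤ 50 * t := by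
  have hre : ((σ : ℂ) + t * Complex.I).re = σ := by simp
  have him : ((σ : ℂ) + t * Complex.I).im = t := by simp
  have hball : ∀ z ∈ Metric.closedBall ((σ : ℂ) + t * Complex.I) (1 / 4),
      |z.re - σ| ≤ 1 / 4 ∧ |z.im - t| ≤ 1 / 4 := by
    intro z hz
    rw [Metric.mem_closedBall, dist_eq_norm] at hz
    constructor
    · simpa [hre] using (Complex.abs_re_le_norm (z - (σ + t * Complex.I))).trans hz
    · simpa [him] using (Complex.abs_im_le_norm (z - (σ + t * Complex.I))).trans hz
  -- Cauchy's estimate on a circle of radius 1/4, which stays in Re s ≥ 1/4. There |ζ| ≤ 5(t + 3/2)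
  -- ≤ 12t, hence |ζ'| ≤ 48t.
  have key := Complex.norm_deriv_le_of_forall_mem_sphere_norm_le (c := (σ : ℂ) + t * Complex.I)
    (R := 1 / 4) (C := 12 * t) (f := riemannZeta) (by norm_num) ?_ ?_
  · refine key.trans ?_
    rw [div_le_iff₀ (by norm_num)]; linarith
  · apply DifferentiableOn.diffContOnCl
    rw [closure_ball _ (by norm_num)]
    intro z hz
    refine (differentiableAt_riemannZeta ?_).differentiableWithinAt
    rintro rfl
    have := (hball 1 hz).2
    simp only [Complex.one_im, zero_sub, abs_neg, abs_of_nonneg (show 0 ≤ t by linarith)] at this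
    linarith
  · intro z hz
    obtain ⟨h1, h2⟩ := hball z (Metric.sphere_subset_closedBall hz)
    rw [abs_le] at h1 h2
    have hz0 : 1 ≤ |z.im| := by rw [abs_of_nonneg] <;> linarith
    refine (norm_riemannZeta_le (by linarith) hz0).trans ?_
    have := Complex.norm_le_abs_re_add_abs_im z
    rw [abs_of_nonneg (show 0 ≤ z.re by linarith), abs_of_nonneg (show 0 ≤ z.im by linarith)] at this
    linarith

/-! ### Values of d_k at prime powers -/

lemma divisorFun_zero_right (k : ℕ) : divisorFun k 0 = 0 := by simp [divisorFun]

lemma isMultiplicative_zeta_pow (k : ℕ) :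
    (ArithmeticFunction.zeta ^ k : ArithmeticFunction ℕ).IsMultiplicative := by
  induction k with
  | zero => rw [pow_zero]; exact ArithmeticFunction.isMultiplicative_one
  | succ k ih => rw [pow_succ]; exact ih.mul ArithmeticFunction.isMultiplicative_zeta

lemma divisorFun_one_right (k : ℕ) : divisorFun k 1 = 1 := (isMultiplicative_zeta_pow k).1

lemma divisorFun_mul (k : ℕ) {m n : ℕ} (h : m.Coprime n) :
    divisorFun k (m * n) = divisorFun k m * divisorFun k n := (isMultiplicative_zeta_pow k).2 h

lemma divisorFun_prime_pow (k a : ℕ) {p : ℕ} (hp : p.Prime) :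
    divisorFun (k + 1) (p ^ a) = (a + k).choose k := by
  induction k generalizing a with
  | zero => simp [divisorFun, ArithmeticFunction.zeta_apply, hp.ne_zero]
  | succ k ih =>
    have : divisorFun (k + 1 + 1) (p ^ a) = ∑ j ∈ Finset.range (a + 1), divisorFun (k + 1) (p ^ j) := by
      unfold divisorFun
      rw [pow_succ _ (k + 1), ArithmeticFunction.mul_zeta_apply, Nat.sum_divisors_prime_pow hp]
    rw [this, Finset.sum_congr rfl fun j _ => ih j, Nat.sum_range_add_choose]
    ring_nf

/-- Passing from a to a + 1 multiplies the binomial coefficient by (a + k + 1)/(a + 1), which is at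
most k + 1. -/
lemma divisorFun_prime_pow_le (k a : ℕ) {p : ℕ} (hp : p.Prime) :
    divisorFun (k + 1) (p ^ a) ≤ (k + 1) ^ a := by
  rw [divisorFun_prime_pow k a hp]
  induction a with
  | zero => simp
  | succ a ih =>
    have h3 : (a + 1 + k).choose k * (a + 1) = (a + k).choose k * (a + k + 1) := by
      have := Nat.choose_mul_succ_eq (a + k) k
      rw [this]
      rw [show a + k + 1 - k = a + 1 by omega, show a + k + 1 = a + 1 + k by ring]
    have h4 : (a + k + 1) ≤ (k + 1) * (a + 1) := by nlinarith [Nat.zero_le (a * k)]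
    have h5 : (a + 1 + k).choose k * (a + 1) ≤ (k + 1) ^ (a + 1) * (a + 1) := by
      rw [h3]
      calc _ ≤ (k + 1) ^ a * ((k + 1) * (a + 1)) := Nat.mul_le_mul ih h4
        _ = _ := by ring
    exact Nat.le_of_mul_le_mul_right h5 (Nat.succ_pos a)

/-! ### Upper bound for the sum of d_k(n)² n^{-2σ} via its Euler product -/

/-- The summand of `divisorSum`. -/
noncomputable def divisorTerm (σ : ℝ) (k n : ℕ) : ℝ :=
  (divisorFun k n : ℝ) ^ 2 / (n : ℝ) ^ (2 * σ)

lemma divisorTerm_nonneg (σ : ℝ) (k n : ℕ) : 0 ≤ divisorTerm σ k n := by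
  unfold divisorTerm; positivity

lemma divisorTerm_one (σ : ℝ) (k : ℕ) : divisorTerm σ k 1 = 1 := by
  simp [divisorTerm, divisorFun_one_right]

lemma divisorTerm_zero (σ : ℝ) (k : ℕ) : divisorTerm σ k 0 = 0 := by
  simp [divisorTerm, divisorFun_zero_right]

lemma divisorTerm_mul (σ : ℝ) (k : ℕ) {m n : ℕ} (h : m.Coprime n) :
    divisorTerm σ k (m * n) = divisorTerm σ k m * divisorTerm σ k n := by
  unfold divisorTerm
  rw [divisorFun_mul k h]
  push_cast
  rw [Real.mul_rpow (by positivity) (by positivity)]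
  field_simp

lemma divisorTerm_prime_pow (σ : ℝ) (k a : ℕ) (p : ℕ) :
    divisorTerm σ k (p ^ a) = ((divisorFun k (p ^ a) : ℝ) * ((p : ℝ) ^ (-σ)) ^ a) ^ 2 := by
  unfold divisorTerm
  rw [mul_pow, div_eq_mul_inv, ← Real.rpow_neg (by positivity)]
  congr 1
  push_cast
  rw [← Real.rpow_natCast (p : ℝ) a, ← Real.rpow_natCast _ a, ← Real.rpow_natCast _ 2,
    ← Real.rpow_mul (by positivity), ← Real.rpow_mul (by positivity), ← Real.rpow_mul (by positivity)]
  congr 1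
  push_cast; ring

/-- Each local factor of `divisorSum` is summable, with a bound adapted to small primes. -/
lemma divisorTerm_prime_pow_small {σ : ℝ} (hσ : 1 / 2 < σ) {k p : ℕ} (hk : 1 ≤ k) (hp : p.Prime) :
    Summable (fun a => divisorTerm σ k (p ^ a)) ∧
      ∑' a, divisorTerm σ k (p ^ a) ≤ Real.exp (8 * k * (p : ℝ) ^ (-σ)) := by
  obtain ⟨k, rfl⟩ : ∃ j, k = j + 1 := ⟨k - 1, by omega⟩
  set x : ℝ := (p : ℝ) ^ (-σ) with hx
  have hp0 : (0 : ℝ) < p := by exact_mod_cast hp.pos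
  have hx0 : 0 < x := Real.rpow_pos_of_pos hp0 _
  -- 3/4 exceeds 2^{-1/2}, and for 0 ≤ x ≤ 3/4 one has 1/(1 - x) ≤ 1 + 4x, as needed for `hUe`.
  have hx34 : x ≤ 3 / 4 := by
    have h1 : x ≤ (2 : ℝ) ^ (-(1 / 2) : ℝ) := by
      calc x ≤ (2 : ℝ) ^ (-σ) :=
            Real.rpow_le_rpow_of_nonpos (by norm_num) (by exact_mod_cast hp.two_le) (by linarith)
        _ ≤ _ := Real.rpow_le_rpow_of_exponent_le (by norm_num) (by linarith)
    refine h1.trans ?_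
    have h2 : ((2 : ℝ) ^ (-(1 / 2) : ℝ)) ^ 2 = 1 / 2 := by
      rw [← Real.rpow_natCast, ← Real.rpow_mul (by norm_num)]
      norm_num [Real.rpow_neg_one]
    nlinarith [Real.rpow_nonneg (show (0:ℝ) ≤ 2 by norm_num) (-(1 / 2))]
  set u : ℕ → ℝ := fun a => ((a + k).choose k : ℝ) * x ^ a with hu
  have hu0 : ∀ a, 0 ≤ u a := fun a => by positivity
  have hsum : HasSum u (1 / (1 - x) ^ (k + 1)) :=
    hasSum_choose_mul_geometric_of_norm_lt_one k
      (by rw [Real.norm_of_nonneg hx0.le]; linarith)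
  have hterm : ∀ a, divisorTerm σ (k + 1) (p ^ a) = u a ^ 2 := fun a => by
    rw [divisorTerm_prime_pow, divisorFun_prime_pow k a hp]
  set U := 1 / (1 - x) ^ (k + 1) with hU
  have hle : ∀ a, u a ≤ U := fun a => hsum.tsum_eq ▸ hsum.summable.le_tsum a fun b _ => hu0 b
  -- The sum of squares is at most the largest term times the sum, hence at most U² with U = (1 -
  -- x)^{-(k+1)}.
  have hle2 : ∀ a, divisorTerm σ (k + 1) (p ^ a) ≤ U * u a := fun a => by
    rw [hterm, sq]; exact mul_le_mul_of_nonneg_right (hle a) (hu0 a)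
  have hs : Summable (fun a => divisorTerm σ (k + 1) (p ^ a)) :=
    Summable.of_nonneg_of_le (fun a => divisorTerm_nonneg _ _ _) hle2 (hsum.summable.mul_left U)
  refine ⟨hs, ?_⟩
  have hUe : U ≤ Real.exp (4 * (k + 1) * x) := by
    have h1 : Real.exp (-(4 * x)) ≤ 1 - x := by
      have h2 : 1 / (1 - x) ≤ Real.exp (4 * x) := by
        calc 1 / (1 - x) ≤ 4 * x + 1 := by
              rw [div_le_iff₀ (by linarith)]; nlinarith
          _ ≤ _ := Real.add_one_le_exp _
      rw [Real.exp_neg, inv_le_comm₀ (Real.exp_pos _) (by linarith), ← one_div]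
      exact h2
    calc U ≤ 1 / (Real.exp (-(4 * x))) ^ (k + 1) := by
          rw [hU]; gcongr
      _ = _ := by
          rw [← Real.exp_nat_mul, one_div, ← Real.exp_neg]; congr 1; push_cast; ring
  calc _ ≤ ∑' a, U * u a := hs.tsum_le_tsum hle2 (hsum.summable.mul_left U)
    _ = U * U := by rw [tsum_mul_left, hsum.tsum_eq]
    _ ≤ Real.exp (4 * (k + 1) * x) * Real.exp (4 * (k + 1) * x) := by
        have : 0 ≤ U := by rw [hU]; have : 0 < 1 - x := by linarith
                           positivity
        gcongr
    _ = _ := by rw [← Real.exp_add]; congr 1; push_cast; ring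

/-- Once k p^{-σ} ≤ 1/2, the bound d_k(p^a) ≤ k^a dominates the local factor by a geometric series
of ratio (k p^{-σ})². The exponent is then quadratic in k p^{-σ}, which makes the sum over large
primes converge. -/
lemma divisorTerm_prime_pow_large {σ : ℝ} {k p : ℕ} (hk : 1 ≤ k) (hp : p.Prime)
    (h : k * (p : ℝ) ^ (-σ) ≤ 1 / 2) :
    ∑' a, divisorTerm σ k (p ^ a) ≤ Real.exp (2 * k ^ 2 * (p : ℝ) ^ (-(2 * σ))) := by
  obtain ⟨k, rfl⟩ : ∃ j, k = j + 1 := ⟨k - 1, by omega⟩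
  set x : ℝ := (p : ℝ) ^ (-σ) with hx
  have hp0 : (0 : ℝ) < p := by exact_mod_cast hp.pos
  have hx0 : 0 < x := Real.rpow_pos_of_pos hp0 _
  set q : ℝ := (((k + 1 : ℕ) : ℝ) * x) ^ 2 with hq
  have hq0 : 0 ≤ q := by positivity
  have hq1 : q ≤ 1 / 2 := by
    have : 0 ≤ ((k + 1 : ℕ) : ℝ) * x := by positivity
    nlinarith
  have hle : ∀ a, divisorTerm σ (k + 1) (p ^ a) ≤ q ^ a := fun a => by
    rw [divisorTerm_prime_pow, hq, ← pow_mul, mul_comm 2 a, pow_mul, mul_pow _ x a]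
    have : (divisorFun (k + 1) (p ^ a) : ℝ) ≤ ((k + 1 : ℕ) : ℝ) ^ a := by
      exact_mod_cast divisorFun_prime_pow_le k a hp
    exact pow_le_pow_left₀ (mul_nonneg (Nat.cast_nonneg _) (pow_nonneg hx0.le a))
      (mul_le_mul_of_nonneg_right this (pow_nonneg hx0.le a)) 2
  have hg := hasSum_geometric_of_lt_one hq0 (by linarith)
  have hs : Summable (fun a => divisorTerm σ (k + 1) (p ^ a)) :=
    Summable.of_nonneg_of_le (fun a => divisorTerm_nonneg _ _ _) hle hg.summable
  calc _ ≤ (1 - q)⁻¹ := (hs.tsum_le_tsum hle hg.summable).trans_eq hg.tsum_eq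
    _ ≤ 2 * q + 1 := by
        rw [← one_div, div_le_iff₀ (by linarith)]; nlinarith
    _ ≤ Real.exp (2 * q) := Real.add_one_le_exp _
    _ = _ := by
        rw [hq, hx, mul_pow, ← Real.rpow_natCast ((p : ℝ) ^ (-σ)), ← Real.rpow_mul hp0.le]
        congr 1
        rw [← mul_assoc]; congr 2; push_cast; ring

lemma sum_Ico_rpow_neg_le {s : ℝ} (hs : 0 < s) (hs1 : s < 1) (a : ℕ) :
    ∑ n ∈ Finset.range a, ((n + 1 : ℕ) : ℝ) ^ (-s) ≤ (a : ℝ) ^ (1 - s) / (1 - s) := by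
  induction a with
  | zero => simp [Real.zero_rpow (show 1 - s ≠ 0 by linarith)]
  | succ a ih =>
    rw [Finset.sum_range_succ]
    have h : (a : ℝ) ^ (1 - s) ≤ ((a + 1 : ℕ) : ℝ) ^ (1 - s) - (1 - s) * ((a + 1 : ℕ) : ℝ) ^ (-s) := by
      set b : ℝ := ((a + 1 : ℕ) : ℝ) with hb
      have hb0 : 0 < b := by positivity
      have hab : (a : ℝ) = b * (1 + -(1 / b)) := by
        field_simp; rw [hb]; push_cast; ring
      have hb1 : 1 / b ≤ 1 := by
        rw [div_le_one hb0, hb]; push_cast; linarith [Nat.cast_nonneg (α := ℝ) a]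
      rw [hab, Real.mul_rpow hb0.le (by linarith)]
      have := rpow_one_add_le_one_add_mul_self (s := -(1 / b)) (p := 1 - s) (by linarith)
        (by linarith) (by linarith)
      have e : b ^ (-s) = b ^ (1 - s) * (1 / b) := by
        rw [show -s = (1 - s) - 1 by ring, Real.rpow_sub hb0, Real.rpow_one]; ring
      rw [e]
      have h0 : 0 < b ^ (1 - s) := Real.rpow_pos_of_pos hb0 _
      nlinarith
    have h1 : 0 < 1 - s := by linarith
    rw [le_div_iff₀ h1] at ih ⊢
    nlinarith

/-- Each term is bounded by a difference of consecutive values of x^{1-s}/(s - 1), so the sum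
telescopes. Keeping the subtracted endpoint is what makes the induction close. -/
lemma sum_Ico_rpow_neg_tail_le {s : ℝ} (hs : 1 < s) {a : ℕ} (ha : 1 ≤ a) (m : ℕ) :
    ∑ n ∈ Finset.range m, ((a + n + 1 : ℕ) : ℝ) ^ (-s) ≤
      ((a : ℝ) ^ (1 - s) - ((a + m : ℕ) : ℝ) ^ (1 - s)) / (s - 1) := by
  induction m with
  | zero => simp
  | succ m ih =>
    rw [Finset.sum_range_succ]
    have h : ((a + m + 1 : ℕ) : ℝ) ^ (1 - s) + (s - 1) * ((a + m + 1 : ℕ) : ℝ) ^ (-s) ≤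
        ((a + m : ℕ) : ℝ) ^ (1 - s) := by
      set b : ℝ := ((a + m + 1 : ℕ) : ℝ) with hb
      have hc : (1 : ℝ) ≤ ((a + m : ℕ) : ℝ) := by exact_mod_cast (by omega : 1 ≤ a + m)
      have hbc : b = ((a + m : ℕ) : ℝ) + 1 := by rw [hb]; push_cast; ring
      set c : ℝ := ((a + m : ℕ) : ℝ) with hcdef
      have hb0 : 0 < b := by linarith
      have hab : c = b * (1 - 1 / b) := by
        field_simp; linarith
      have hx : 0 < 1 - 1 / b := by
        rw [sub_pos, div_lt_one hb0]; linarith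
      have hx1 : 1 - 1 / b ≤ Real.exp (-(1 / b)) := by
        have := Real.add_one_le_exp (-(1 / b)); linarith
      rw [hab, Real.mul_rpow hb0.le hx.le]
      have h2 : 1 + (s - 1) * (1 / b) ≤ (1 - 1 / b) ^ (1 - s) := by
        calc 1 + (s - 1) * (1 / b) ≤ Real.exp ((s - 1) * (1 / b)) := by
              rw [add_comm]; exact Real.add_one_le_exp _
          _ = Real.exp (-(1 / b)) ^ (1 - s) := by
              rw [← Real.exp_mul]; congr 1; ring
          _ ≤ _ := Real.rpow_le_rpow_of_nonpos hx hx1 (by linarith)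
      have e : b ^ (-s) = b ^ (1 - s) * (1 / b) := by
        rw [show -s = (1 - s) - 1 by ring, Real.rpow_sub hb0, Real.rpow_one]; ring
      rw [e]
      have h0 : 0 < b ^ (1 - s) := Real.rpow_pos_of_pos hb0 _
      nlinarith
    have h1 : 0 < s - 1 := by linarith
    rw [le_div_iff₀ h1] at ih ⊢
    rw [← add_assoc a m 1] at *
    nlinarith

/-- The finite partial sums of `divisorSum` are bounded by the Euler product. -/
lemma sum_divisorTerm_le_exp {σ : ℝ} (hσ : 1 / 2 < σ) {k : ℕ} (hk : 1 ≤ k) (b : ℕ → ℝ)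
    (hb : ∀ p : ℕ, p.Prime → ∑' a, divisorTerm σ k (p ^ a) ≤ Real.exp (b p))
    (hb0 : ∀ n, 0 ≤ b n) (N : ℕ) :
    ∑ n ∈ Finset.range N, divisorTerm σ k n ≤ Real.exp (∑ n ∈ Finset.Ico 2 N, b n) := by
  obtain ⟨h1, h2⟩ := EulerProduct.summable_and_hasSum_factoredNumbers_prod_filter_prime_tsum
    (f := divisorTerm σ k) (divisorTerm_one σ k) (fun h => divisorTerm_mul σ k h)
    (fun hp => by
      simpa [Real.norm_of_nonneg (divisorTerm_nonneg σ k _)] using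
        (divisorTerm_prime_pow_small hσ hk hp).1) (Finset.Ico 2 N)
  calc ∑ n ∈ Finset.range N, divisorTerm σ k n
      = ∑ n ∈ (Finset.range N).filter (· ≠ 0), divisorTerm σ k n := by
        rw [Finset.sum_filter_of_ne]
        rintro n - h rfl
        exact h (divisorTerm_zero σ k)
    _ ≤ ∑' n : Nat.factoredNumbers (Finset.Ico 2 N), divisorTerm σ k n := by
        have hmem : ∀ n ∈ (Finset.range N).filter (· ≠ 0),
            n ∈ Nat.factoredNumbers (Finset.Ico 2 N) := by
          intro n hn
          rw [Finset.mem_filter, Finset.mem_range] at hn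
          refine ⟨hn.2, fun p hp => ?_⟩
          rw [Nat.mem_primeFactorsList hn.2] at hp
          rw [Finset.mem_Ico]
          exact ⟨hp.1.two_le, (Nat.le_of_dvd (Nat.pos_of_ne_zero hn.2) hp.2).trans_lt hn.1⟩
        rw [← Finset.sum_subtype_of_mem (p := (· ∈ Nat.factoredNumbers (Finset.Ico 2 N))) _ hmem]
        exact h2.summable.sum_le_tsum _ fun n _ => divisorTerm_nonneg σ k n
    _ = ∏ p ∈ (Finset.Ico 2 N).filter Nat.Prime, ∑' a, divisorTerm σ k (p ^ a) := h2.tsum_eq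
    _ ≤ ∏ p ∈ (Finset.Ico 2 N).filter Nat.Prime, Real.exp (b p) :=
        Finset.prod_le_prod (fun p _ => tsum_nonneg fun a => divisorTerm_nonneg _ _ _)
          fun p hp => hb p (Finset.mem_filter.mp hp).2
    _ = Real.exp (∑ p ∈ (Finset.Ico 2 N).filter Nat.Prime, b p) := (Real.exp_sum _ _).symm
    _ ≤ _ := by
        rw [Real.exp_le_exp]
        exact Finset.sum_le_sum_of_subset_of_nonneg (Finset.filter_subset _ _) fun n _ _ => hb0 n

/-- The primes are split at y = (2k)^{1/σ}, the point where k y^{-σ} = 1/2. As k is comparable to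
y^σ, the small primes give 8k Σ n^{-σ} ≪ k y^{1-σ} ≪ y, and the large ones 2k² Σ n^{-2σ} ≪ k²
y^{1-2σ} ≪ y. Summing over all integers instead of primes loses nothing that matters here. -/
lemma sum_divisorTerm_le {σ : ℝ} (hσ : 1 / 2 < σ) (hσ1 : σ < 1) {k : ℕ} (hk : 1 ≤ k) (N : ℕ) :
    ∑ n ∈ Finset.range N, divisorTerm σ k n ≤
      Real.exp ((16 / (1 - σ) + 4 / (2 * σ - 1)) * (k : ℝ) ^ (1 / σ)) := by
  have hσ0 : 0 < σ := by linarith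
  have hk1 : (1 : ℝ) ≤ k := by exact_mod_cast hk
  set y : ℝ := (2 * (k : ℝ)) ^ (1 / σ) with hy
  have hy2 : 2 ≤ y := by
    calc (2 : ℝ) = 2 ^ (1 : ℝ) := by simp
      _ ≤ 2 ^ (1 / σ) := Real.rpow_le_rpow_of_exponent_le (by norm_num)
          (by rw [le_div_iff₀ hσ0]; linarith)
      _ ≤ y := Real.rpow_le_rpow (by norm_num) (by linarith) (by positivity)
  have hy0 : 0 < y := by linarith
  have hyσ : y ^ σ = 2 * k := by
    rw [hy, ← Real.rpow_mul (by positivity), one_div_mul_cancel hσ0.ne', Real.rpow_one]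
  have hy4 : y ≤ 4 * (k : ℝ) ^ (1 / σ) := by
    rw [hy, Real.mul_rpow (by norm_num) (by positivity)]
    gcongr
    calc (2 : ℝ) ^ (1 / σ) ≤ 2 ^ (2 : ℝ) := Real.rpow_le_rpow_of_exponent_le (by norm_num)
          (by rw [div_le_iff₀ hσ0]; linarith)
      _ = 4 := by norm_num
  set a : ℕ := ⌊y⌋₊ with ha
  have hay : (a : ℝ) ≤ y := Nat.floor_le hy0.le
  have hya : y < a + 1 := Nat.lt_floor_add_one y
  have ha1 : 1 ≤ a := Nat.one_le_floor_iff y |>.mpr (by linarith)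
  set b : ℕ → ℝ := fun n => if n ≤ a then 8 * k * (n : ℝ) ^ (-σ)
    else 2 * k ^ 2 * (n : ℝ) ^ (-(2 * σ)) with hbdef
  have hb0 : ∀ n, 0 ≤ b n := fun n => by
    simp only [hbdef]; split_ifs <;> positivity
  have hb : ∀ p : ℕ, p.Prime → ∑' j, divisorTerm σ k (p ^ j) ≤ Real.exp (b p) := by
    intro p hp
    simp only [hbdef]
    split_ifs with h
    · exact (divisorTerm_prime_pow_small hσ hk hp).2
    · apply divisorTerm_prime_pow_large hk hp
      have hpy : y ≤ p := by
        have : (a : ℝ) + 1 ≤ p := by exact_mod_cast (by omega : a + 1 ≤ p)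
        linarith
      have : (p : ℝ) ^ (-σ) ≤ y ^ (-σ) :=
        Real.rpow_le_rpow_of_nonpos hy0 hpy (by linarith)
      rw [Real.rpow_neg hy0.le, hyσ] at this
      calc k * (p : ℝ) ^ (-σ) ≤ k * (2 * (k : ℝ))⁻¹ := by gcongr
        _ = 1 / 2 := by field_simp
  refine (sum_divisorTerm_le_exp hσ hk b hb hb0 N).trans ?_
  rw [Real.exp_le_exp]
  have hsmall : ∑ n ∈ Finset.range a, b (n + 1) ≤ 4 * y / (1 - σ) := by
    calc ∑ n ∈ Finset.range a, b (n + 1)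
        = 8 * k * ∑ n ∈ Finset.range a, ((n + 1 : ℕ) : ℝ) ^ (-σ) := by
          rw [Finset.mul_sum]
          refine Finset.sum_congr rfl fun n hn => ?_
          rw [Finset.mem_range] at hn
          simp only [hbdef]; rw [if_pos (by omega)]
      _ ≤ 8 * k * ((a : ℝ) ^ (1 - σ) / (1 - σ)) := by
          gcongr; exact sum_Ico_rpow_neg_le hσ0 hσ1 a
      _ ≤ 8 * k * (y ^ (1 - σ) / (1 - σ)) := by
          have : 0 < 1 - σ := by linarith
          gcongr
      _ = 4 * y / (1 - σ) := by
          rw [Real.rpow_sub hy0, Real.rpow_one, hyσ]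
          field_simp; norm_num
  have hlarge : ∀ m : ℕ, ∑ n ∈ Finset.range m, b (a + n + 1) ≤ y / (2 * σ - 1) := by
    intro m
    calc ∑ n ∈ Finset.range m, b (a + n + 1)
        = 2 * k ^ 2 * ∑ n ∈ Finset.range m, ((a + n + 1 : ℕ) : ℝ) ^ (-(2 * σ)) := by
          rw [Finset.mul_sum]
          refine Finset.sum_congr rfl fun n hn => ?_
          simp only [hbdef]; rw [if_neg (by omega)]
      _ ≤ 2 * k ^ 2 * (((a : ℝ) ^ (1 - 2 * σ) - ((a + m : ℕ) : ℝ) ^ (1 - 2 * σ)) / (2 * σ - 1)) := by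
          gcongr; exact sum_Ico_rpow_neg_tail_le (by linarith) ha1 m
      _ ≤ 2 * k ^ 2 * ((y / 2) ^ (1 - 2 * σ) / (2 * σ - 1)) := by
          have : 0 < 2 * σ - 1 := by linarith
          gcongr
          have h1 : (a : ℝ) ^ (1 - 2 * σ) ≤ (y / 2) ^ (1 - 2 * σ) :=
            Real.rpow_le_rpow_of_nonpos (by linarith) (by linarith) (by linarith)
          have h2 : (0 : ℝ) ≤ ((a + m : ℕ) : ℝ) ^ (1 - 2 * σ) := by positivity
          linarith
      _ ≤ 2 * k ^ 2 * ((2 * (y / (2 * k) ^ 2)) / (2 * σ - 1)) := by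
          have : 0 < 2 * σ - 1 := by linarith
          gcongr
          rw [Real.div_rpow hy0.le (by norm_num), Real.rpow_sub hy0, Real.rpow_one, mul_comm 2 σ,
            Real.rpow_mul hy0.le, hyσ, Real.rpow_two, div_eq_mul_inv (y / _), ← Real.rpow_neg (by norm_num),
            mul_comm]
          gcongr
          calc (2 : ℝ) ^ (-(1 - σ * 2)) ≤ 2 ^ (1 : ℝ) :=
              Real.rpow_le_rpow_of_exponent_le (by norm_num) (by linarith)
            _ = 2 := by simp
      _ = y / (2 * σ - 1) := by field_simp
  have htot : ∑ n ∈ Finset.Ico 2 N, b n ≤ ∑ n ∈ Finset.range (a + N), b (n + 1) := by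
    rw [Finset.range_eq_Ico, Finset.sum_Ico_add' b 0 (a + N) 1]
    refine Finset.sum_le_sum_of_subset_of_nonneg ?_ fun n _ _ => hb0 n
    intro n hn
    rw [Finset.mem_Ico] at hn ⊢
    omega
  rw [Finset.sum_range_add] at htot
  have h1 : 0 < 1 - σ := by linarith
  have h2 : 0 < 2 * σ - 1 := by linarith
  calc _ ≤ _ := htot
    _ ≤ 4 * y / (1 - σ) + y / (2 * σ - 1) := add_le_add hsmall (hlarge N)
    _ = (4 / (1 - σ) + 1 / (2 * σ - 1)) * y := by ring
    _ ≤ (4 / (1 - σ) + 1 / (2 * σ - 1)) * (4 * (k : ℝ) ^ (1 / σ)) := by gcongr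
    _ = _ := by ring

lemma summable_divisorTerm {σ : ℝ} (hσ : 1 / 2 < σ) (hσ1 : σ < 1) {k : ℕ} (hk : 1 ≤ k) :
    Summable (divisorTerm σ k) :=
  summable_of_sum_range_le (divisorTerm_nonneg σ k) (sum_divisorTerm_le hσ hσ1 hk)

lemma divisorSum_le {σ : ℝ} (hσ : 1 / 2 < σ) (hσ1 : σ < 1) {k : ℕ} (hk : 1 ≤ k) :
    divisorSum σ k ≤ Real.exp ((16 / (1 - σ) + 4 / (2 * σ - 1)) * (k : ℝ) ^ (1 / σ)) :=
  Real.tsum_le_of_sum_range_le (divisorTerm_nonneg σ k) (sum_divisorTerm_le hσ hσ1 hk)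

/-- The term n = 1 alone equals 1. This lets absolute errors be read as relative ones. -/
lemma one_le_divisorSum {σ : ℝ} (hσ : 1 / 2 < σ) (hσ1 : σ < 1) {k : ℕ} (hk : 1 ≤ k) :
    1 ≤ divisorSum σ k := by
  have := (summable_divisorTerm hσ hσ1 hk).le_tsum 1 fun n _ => divisorTerm_nonneg σ k n
  rwa [divisorTerm_one] at this

/-! ### The Dirichlet series of ζ^k -/

/-- `d_k(n)` as a complex arithmetic function. -/
lemma natCoe_zeta_pow_apply (k n : ℕ) :
    ((ArithmeticFunction.zeta : ArithmeticFunction ℂ) ^ k) n = (divisorFun k n : ℂ) := by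
  induction k generalizing n with
  | zero => simp [divisorFun, ArithmeticFunction.one_apply]
  | succ k ih =>
    rw [pow_succ, ArithmeticFunction.coe_mul_zeta_apply]
    unfold divisorFun
    rw [pow_succ, ArithmeticFunction.mul_zeta_apply]
    push_cast
    exact Finset.sum_congr rfl fun j _ => ih j

lemma LSeriesHasSum_divisorFun (k : ℕ) {s : ℂ} (hs : 1 < s.re) :
    LSeriesHasSum (fun n => (divisorFun k n : ℂ)) s (riemannZeta s ^ k) := by
  simp_rw [← natCoe_zeta_pow_apply]
  induction k with
  | zero =>
    rw [pow_zero, pow_zero]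
    rw [ArithmeticFunction.one_eq_delta]
    unfold LSeriesHasSum
    rw [show LSeries.term LSeries.delta s = fun n => if n = 1 then 1 else 0 from
      funext (LSeries.term_delta s)]
    exact hasSum_ite_eq 1 1
  | succ k ih =>
    rw [pow_succ, pow_succ]
    have hz : LSeriesHasSum (fun n => (ArithmeticFunction.zeta : ArithmeticFunction ℂ) n) s
        (riemannZeta s) := by
      simpa using ArithmeticFunction.LSeriesHasSum_zeta hs
    exact ArithmeticFunction.LSeriesHasSum_mul ih hz

/-! ### Cauchy's integral formula on a rectangle -/

section RectangleIntegral
open Complex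

lemma add_mul_I_mem_slitPlane {c : ℝ} (hc : 0 < c) (x : ℝ) : (c + x * I : ℂ) ∈ slitPlane := by
  left; simpa using hc

lemma integral_div_add_mul_I {c : ℝ} (hc : 0 < c) (e p q : ℝ) :
    ∫ y in p..q, (e * I) / (c + (e * y : ℝ) * I) =
      log (c + (e * q : ℝ) * I) - log (c + (e * p : ℝ) * I) := by
  refine intervalIntegral.integral_eq_sub_of_hasDerivAt
    (f := fun y : ℝ => log (c + (e * y : ℝ) * I)) (fun y _ => ?_) ?_
  · have h : HasDerivAt (fun y : ℝ => (c + (e * y : ℝ) * I : ℂ)) (e * I) y := by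
      have h1 : HasDerivAt (fun y : ℝ => ((e * y : ℝ) : ℂ)) ((e * 1 : ℝ) : ℂ) y :=
        ((hasDerivAt_id y).const_mul e).ofReal_comp
      simpa using (h1.mul_const I).const_add (c : ℂ)
    exact h.clog_real (add_mul_I_mem_slitPlane hc _)
  · refine Continuous.intervalIntegrable ?_ _ _
    refine Continuous.div (by fun_prop) (by fun_prop) fun y => ?_
    exact slitPlane_ne_zero (add_mul_I_mem_slitPlane hc _)

/-- The points b ± ia are quarter turns of a ∓ ib. The latter have |arg| < π/2, so multiplying by ±i
does not leave the principal branch, and only the two quarter turns survive. -/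
lemma log_sub_log_add_log_sub_log {a : ℝ} (ha : 0 < a) (b : ℝ) :
    (log (a + b * I) - log (a + (-b : ℝ) * I)) + (log (b + a * I) - log (b + (-a : ℝ) * I)) =
      Real.pi * I := by
  have h1 : (b + a * I : ℂ) = I * (a + (-b : ℝ) * I) := by
    push_cast; linear_combination (b : ℂ) * I_sq
  have h2 : (b + (-a : ℝ) * I : ℂ) = (-I) * (a + b * I) := by
    push_cast; linear_combination (b : ℂ) * I_sq
  have harg : ∀ x : ℝ, |(a + x * I : ℂ).arg| < Real.pi / 2 := fun x => by
    rw [abs_arg_lt_pi_div_two_iff]; left; simpa using ha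
  have hpi := Real.pi_pos
  have g1 := abs_lt.mp (harg (-b))
  have g2 := abs_lt.mp (harg b)
  rw [h1, h2, log_mul I_ne_zero (slitPlane_ne_zero (add_mul_I_mem_slitPlane ha _)),
    log_mul (neg_ne_zero.mpr I_ne_zero) (slitPlane_ne_zero (add_mul_I_mem_slitPlane ha _)),
    log_I, log_neg_I]
  · ring
  · rw [arg_neg_I]; constructor <;> linarith [g2.1, g2.2]
  · rw [arg_I]; constructor <;> linarith [g1.1, g1.2]

/-- The integral of `1 / z` around a rectangle that contains `0` in its interior. -/
lemma integral_boundary_rect_inv {a b V : ℝ} (ha : 0 < a) (hb : 0 < b) (hV : 0 < V) :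
    (∫ x in (-a)..b, ((x : ℂ) + (-V : ℝ) * I)⁻¹) - (∫ x in (-a)..b, ((x : ℂ) + (V : ℝ) * I)⁻¹) +
      I * (∫ y in (-V)..V, ((b : ℂ) + y * I)⁻¹) - I * (∫ y in (-V)..V, (((-a : ℝ) : ℂ) + y * I)⁻¹) =
      2 * Real.pi * I := by
  -- Each side is rotated into the right half-plane, where the principal logarithm is a primitive;
  -- this avoids the branch cut on the left side.
  have e1 : ∀ x : ℝ, ((x : ℂ) + (-V : ℝ) * I)⁻¹ = ((1 : ℝ) * I) / (V + (1 * x : ℝ) * I) := by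
    intro x
    have : (V + (1 * x : ℝ) * I : ℂ) = I * (x + (-V : ℝ) * I) := by
      push_cast; linear_combination (V : ℂ) * I_sq
    rw [this, ofReal_one, one_mul, div_mul_eq_div_div, div_self I_ne_zero, one_div]
  have e2 : ∀ x : ℝ, ((x : ℂ) + (V : ℝ) * I)⁻¹ = ((-1 : ℝ) * I) / (V + (-1 * x : ℝ) * I) := by
    intro x
    have : (V + (-1 * x : ℝ) * I : ℂ) = (-I) * (x + V * I) := by
      push_cast; linear_combination (V : ℂ) * I_sq
    have h : ((-1 : ℝ) : ℂ) * I = -I := by push_cast; ring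
    rw [this, h, div_mul_eq_div_div, div_self (neg_ne_zero.mpr I_ne_zero), one_div]
  have e3 : ∀ y : ℝ, I * ((b : ℂ) + y * I)⁻¹ = ((1 : ℝ) * I) / (b + (1 * y : ℝ) * I) := by
    intro y; push_cast; rw [one_mul, one_mul, div_eq_mul_inv]
  have e4 : ∀ y : ℝ, I * (((-a : ℝ) : ℂ) + y * I)⁻¹ = ((-1 : ℝ) * I) / (a + (-1 * y : ℝ) * I) := by
    intro y
    have : (a + (-1 * y : ℝ) * I : ℂ) = -(((-a : ℝ) : ℂ) + y * I) := by push_cast; ring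
    rw [this, div_neg, div_eq_mul_inv]; push_cast; ring
  rw [← intervalIntegral.integral_const_mul, ← intervalIntegral.integral_const_mul]
  simp_rw [e1, e2, e3, e4]
  rw [integral_div_add_mul_I hV, integral_div_add_mul_I hV, integral_div_add_mul_I hb,
    integral_div_add_mul_I ha]
  have f1 := log_sub_log_add_log_sub_log hV a
  have f2 := log_sub_log_add_log_sub_log hV b
  simp only [one_mul, neg_mul, neg_neg, mul_neg] at f1 f2 ⊢
  linear_combination f1 + f2

/-- The Cauchy integral formula at the origin for a rectangle. -/
lemma integral_boundary_rect_div {a b V : ℝ} (ha : 0 < a) (hb : 0 < b) (hV : 0 < V) {H : ℂ → ℂ}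
    (hH : ∀ w : ℂ, -a ≤ w.re → w.re ≤ b → |w.im| ≤ V → DifferentiableAt ℂ H w) :
    (∫ x in (-a)..b, H (x + (-V : ℝ) * I) * ((x : ℂ) + (-V : ℝ) * I)⁻¹) -
      (∫ x in (-a)..b, H (x + (V : ℝ) * I) * ((x : ℂ) + (V : ℝ) * I)⁻¹) +
      I * (∫ y in (-V)..V, H (b + y * I) * ((b : ℂ) + y * I)⁻¹) -
      I * (∫ y in (-V)..V, H ((-a : ℝ) + y * I) * (((-a : ℝ) : ℂ) + y * I)⁻¹) =
      2 * Real.pi * I * H 0 := by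
  have hab : -a ≤ b := by linarith
  have hVV : -V ≤ V := by linarith
  have hnhds : ((uIcc (-a) b) ×ℂ (uIcc (-V) V)) ∈ 𝓝 (0 : ℂ) := by
    rw [uIcc_of_le hab, uIcc_of_le hVV]
    have h1 : ∀ᶠ z : ℂ in 𝓝 0, z.re ∈ Icc (-a) b :=
      continuous_re.continuousAt.eventually (Icc_mem_nhds (by simpa using ha) (by simpa using hb))
    have h2 : ∀ᶠ z : ℂ in 𝓝 0, z.im ∈ Icc (-V) V :=
      continuous_im.continuousAt.eventually (Icc_mem_nhds (by simpa using hV) (by simpa using hV))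
    filter_upwards [h1, h2] with z hz1 hz2
    exact mem_reProdIm.mpr ⟨hz1, hz2⟩
  have hdiff : ∀ w ∈ (uIcc (-a) b) ×ℂ (uIcc (-V) V), DifferentiableAt ℂ H w := by
    intro w hw
    rw [uIcc_of_le hab, uIcc_of_le hVV, mem_reProdIm] at hw
    exact hH w hw.1.1 hw.1.2 (abs_le.mpr hw.2)
  -- The slope (H(w) - H(0))/w is holomorphic across 0, so its boundary integral vanishes. What
  -- remains is H(0) times the integral of 1/w.
  have hd : DifferentiableOn ℂ (dslope H 0) ((uIcc (-a) b) ×ℂ (uIcc (-V) V)) :=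
    (differentiableOn_dslope hnhds).mpr fun w hw => (hdiff w hw).differentiableWithinAt
  have key := integral_boundary_rect_eq_zero_of_differentiableOn (dslope H 0)
    (⟨-a, -V⟩ : ℂ) (⟨b, V⟩ : ℂ) hd
  simp only [smul_eq_mul] at key
  have hds : ∀ w : ℂ, w ≠ 0 → dslope H 0 w = H w * w⁻¹ - H 0 * w⁻¹ := by
    intro w hw
    rw [dslope_of_ne _ hw, slope_def_field, sub_zero, div_eq_mul_inv]; ring
  have hre : ∀ x y : ℝ, (x : ℂ) + y * I = ⟨x, y⟩ := fun x y => by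
    apply Complex.ext <;> simp
  have hcontH : ∀ x y : ℝ, x ∈ Icc (-a) b → y ∈ Icc (-V) V → ContinuousAt H (x + y * I) := by
    intro x y hx hy
    rw [hre]
    exact (hH ⟨x, y⟩ hx.1 hx.2 (abs_le.mpr hy)).continuousAt
  have nz1 : ∀ x y : ℝ, y ≠ 0 → (x : ℂ) + y * I ≠ 0 := fun x y hy h => by
    apply hy; simpa using congrArg Complex.im h
  have nz2 : ∀ x y : ℝ, x ≠ 0 → (x : ℂ) + y * I ≠ 0 := fun x y hx h => by
    apply hx; simpa using congrArg Complex.re h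
  have horiz : ∀ v ∈ Icc (-V) V, v ≠ 0 → ∫ x in (-a)..b, dslope H 0 (x + v * I) =
      (∫ x in (-a)..b, H (x + v * I) * ((x : ℂ) + v * I)⁻¹) -
        H 0 * ∫ x in (-a)..b, ((x : ℂ) + v * I)⁻¹ := by
    intro v hv hv0
    have hi : ContinuousOn (fun x : ℝ => ((x : ℂ) + v * I)⁻¹) (uIcc (-a) b) :=
      ContinuousOn.inv₀ (by fun_prop) fun x _ => nz1 x v hv0
    have hc : ContinuousOn (fun x : ℝ => H (x + v * I)) (uIcc (-a) b) := by
      intro x hx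
      rw [uIcc_of_le hab] at hx
      exact (ContinuousAt.comp (f := fun x : ℝ => (x : ℂ) + v * I) (hcontH x v hx hv)
        (by fun_prop)).continuousWithinAt
    have hm : ContinuousOn (fun x : ℝ => H ((x : ℂ) + v * I) * ((x : ℂ) + v * I)⁻¹) (uIcc (-a) b) := hc.mul hi
    have hm' : ContinuousOn (fun x : ℝ => H 0 * ((x : ℂ) + v * I)⁻¹) (uIcc (-a) b) := continuousOn_const.mul hi
    rw [← intervalIntegral.integral_const_mul, ← intervalIntegral.integral_sub
      hm.intervalIntegrable hm'.intervalIntegrable]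
    exact intervalIntegral.integral_congr fun x _ => hds _ (nz1 x v hv0)
  have vert : ∀ u ∈ Icc (-a) b, u ≠ 0 → ∫ y in (-V)..V, dslope H 0 (u + y * I) =
      (∫ y in (-V)..V, H (u + y * I) * ((u : ℂ) + y * I)⁻¹) -
        H 0 * ∫ y in (-V)..V, ((u : ℂ) + y * I)⁻¹ := by
    intro u hu hu0
    have hi : ContinuousOn (fun y : ℝ => ((u : ℂ) + y * I)⁻¹) (uIcc (-V) V) :=
      ContinuousOn.inv₀ (by fun_prop) fun y _ => nz2 u y hu0
    have hc : ContinuousOn (fun y : ℝ => H (u + y * I)) (uIcc (-V) V) := by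
      intro y hy
      rw [uIcc_of_le hVV] at hy
      exact (ContinuousAt.comp (f := fun y : ℝ => (u : ℂ) + y * I) (hcontH u y hu hy)
        (by fun_prop)).continuousWithinAt
    have hm : ContinuousOn (fun y : ℝ => H ((u : ℂ) + y * I) * ((u : ℂ) + y * I)⁻¹) (uIcc (-V) V) := hc.mul hi
    have hm' : ContinuousOn (fun y : ℝ => H 0 * ((u : ℂ) + y * I)⁻¹) (uIcc (-V) V) := continuousOn_const.mul hi
    rw [← intervalIntegral.integral_const_mul, ← intervalIntegral.integral_sub
      hm.intervalIntegrable hm'.intervalIntegrable]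
    exact intervalIntegral.integral_congr fun y _ => hds _ (nz2 u y hu0)
  rw [horiz (-V) ⟨le_rfl, hVV⟩ (by linarith), horiz V ⟨hVV, le_rfl⟩ hV.ne',
    vert b ⟨hab, le_rfl⟩ hb.ne', vert (-a) ⟨le_rfl, hab⟩ (by linarith)] at key
  have hinv := integral_boundary_rect_inv ha hb hV
  linear_combination key + H 0 * hinv

end RectangleIntegral

/-! ### A truncated Perron formula with Gaussian weight -/

section SmoothedPerron
open Complex

/-- The Gaussian Perron kernel `X ^ w * exp (w ^ 2)`. -/
noncomputable def perronWeight (X : ℝ) (w : ℂ) : ℂ := (X : ℂ) ^ w * exp (w ^ 2)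

/-- The truncated smoothed Perron integral of `G` over the segment `[2 - iV, 2 + iV]`. -/
noncomputable def perronAvg (X V : ℝ) (G : ℂ → ℂ) : ℂ :=
  (1 / (2 * Real.pi) : ℝ) * ∫ y in (-V)..V,
    G ((2 : ℝ) + y * I) * perronWeight X ((2 : ℝ) + y * I) * (((2 : ℝ) : ℂ) + y * I)⁻¹

lemma norm_perronWeight {X : ℝ} (hX : 0 < X) (x y : ℝ) :
    ‖perronWeight X (x + y * I)‖ = X ^ x * (Real.exp (x ^ 2) * Real.exp (-y ^ 2)) := by
  unfold perronWeight
  rw [norm_mul, norm_cpow_eq_rpow_re_of_pos hX, norm_exp, ← Real.exp_add]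
  congr 2
  · simp
  · simp [sq]; ring

lemma differentiable_perronWeight {X : ℝ} (hX : 0 < X) : Differentiable ℂ (perronWeight X) := by
  have : (X : ℂ) ≠ 0 := by exact_mod_cast hX.ne'
  intro w
  refine DifferentiableAt.mul ?_ (by fun_prop)
  exact DifferentiableAt.const_cpow differentiableAt_id (Or.inl this)

lemma perronWeight_zero (X : ℝ) : perronWeight X 0 = 1 := by simp [perronWeight]

lemma two_add_mul_I_ne_zero (y : ℝ) : ((2 : ℝ) : ℂ) + y * I ≠ 0 :=
  slitPlane_ne_zero (add_mul_I_mem_slitPlane two_pos y)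

lemma integral_exp_neg_sq_le (V : ℝ) (hV : 0 ≤ V) :
    ∫ y in (-V)..V, Real.exp (-y ^ 2) ≤ Real.pi := by
  calc ∫ y in (-V)..V, Real.exp (-y ^ 2) ≤ ∫ y in (-V)..V, 1 / (1 + y ^ 2) := by
        refine intervalIntegral.integral_mono_on (by linarith)
          (Continuous.intervalIntegrable (by fun_prop) _ _) ?_ fun y _ => ?_
        · refine Continuous.intervalIntegrable ?_ _ _
          exact Continuous.div (by fun_prop) (by fun_prop) fun y => by positivity
        · rw [Real.exp_neg, ← one_div]
          exact one_div_le_one_div_of_le (by positivity)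
            (by linarith [Real.add_one_le_exp (y ^ 2)])
    _ = Real.arctan V - Real.arctan (-V) := integral_one_div_one_add_sq
    _ ≤ Real.pi := by
        linarith [Real.arctan_lt_pi_div_two V, Real.neg_pi_div_two_lt_arctan (-V)]

/-- Estimate of an integral along a vertical segment against the Gaussian kernel. -/
lemma norm_integral_perronWeight_le {X V x M c : ℝ} (hX : 0 < X) (hV : 0 ≤ V) (hM : 0 ≤ M)
    (hc : 0 < c) (hcx : c ≤ |x|) {G : ℂ → ℂ} (hG : ∀ y ∈ Icc (-V) V, ‖G (x + y * I)‖ ≤ M) :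
    ‖∫ y in (-V)..V, G (x + y * I) * perronWeight X (x + y * I) * ((x : ℂ) + y * I)⁻¹‖ ≤
      M * X ^ x * Real.exp (x ^ 2) * c⁻¹ * Real.pi := by
  have hVV : -V ≤ V := by linarith
  calc _ ≤ ∫ y in (-V)..V, M * X ^ x * Real.exp (x ^ 2) * c⁻¹ * Real.exp (-y ^ 2) := by
        refine intervalIntegral.norm_integral_le_of_norm_le hVV ?_
          (Continuous.intervalIntegrable (by fun_prop) _ _)
        refine Eventually.of_forall fun y hy => ?_
        rw [norm_mul, norm_mul, norm_perronWeight hX, norm_inv]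
        have h1 : c ≤ ‖(x : ℂ) + y * I‖ := by
          refine hcx.trans ?_
          simpa using abs_re_le_norm ((x : ℂ) + y * I)
        have h2 := hG y (Ioc_subset_Icc_self hy)
        calc _ ≤ M * (X ^ x * (Real.exp (x ^ 2) * Real.exp (-y ^ 2))) * c⁻¹ := by gcongr
          _ = _ := by ring
    _ = M * X ^ x * Real.exp (x ^ 2) * c⁻¹ * ∫ y in (-V)..V, Real.exp (-y ^ 2) :=
        intervalIntegral.integral_const_mul _ _
    _ ≤ _ := by
        gcongr
        exact integral_exp_neg_sq_le V hV

lemma norm_perronAvg_le {X V M : ℝ} (hX : 0 < X) (hV : 0 ≤ V) (hM : 0 ≤ M) {G : ℂ → ℂ}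
    (hG : ∀ y ∈ Icc (-V) V, ‖G ((2 : ℝ) + y * I)‖ ≤ M) :
    ‖perronAvg X V G‖ ≤ M * X ^ 2 * Real.exp 4 := by
  unfold perronAvg
  have h := norm_integral_perronWeight_le (x := 2) (c := 2) hX hV hM two_pos (by norm_num) hG
  rw [norm_mul, norm_real, Real.norm_of_nonneg (by positivity)]
  calc _ ≤ 1 / (2 * Real.pi) * (M * X ^ (2 : ℝ) * Real.exp (2 ^ 2) * 2⁻¹ * Real.pi) := by gcongr
    _ = M * X ^ 2 * Real.exp 4 / 4 := by
        rw [Real.rpow_two]; norm_num; field_simp; ring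
    _ ≤ _ := by
        have : 0 ≤ M * X ^ 2 * Real.exp 4 := by positivity
        linarith

/-- The error in the smoothed Perron formula. -/
noncomputable def perronError (X V η : ℝ) : ℝ := 2 * X ^ (-η) / η + X ^ 2 * Real.exp (4 - V ^ 2)

/-- The smoothed truncated Perron formula: shifting the contour to `Re w = -η`. -/
lemma norm_sub_perronAvg_le {X V η M : ℝ} (hX : 1 ≤ X) (hV : 1 ≤ V) (hη : 0 < η) (hη1 : η ≤ 1)
    {G : ℂ → ℂ}
    (hG : ∀ w : ℂ, -η ≤ w.re → w.re ≤ 2 → |w.im| ≤ V → DifferentiableAt ℂ G w)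
    (hGM : ∀ w : ℂ, -η ≤ w.re → w.re ≤ 2 → |w.im| ≤ V → ‖G w‖ ≤ M) :
    ‖G 0 - perronAvg X V G‖ ≤ M * perronError X V η := by
  have hX0 : 0 < X := by linarith
  have hV0 : 0 < V := by linarith
  have hM : 0 ≤ M := (norm_nonneg _).trans (hGM 0 (by simpa using hη.le) (by simp) (by simpa using hV0.le))
  have key := integral_boundary_rect_div hη two_pos hV0 (H := fun w => G w * perronWeight X w)
    fun w h1 h2 h3 => (hG w h1 h2 h3).mul (differentiable_perronWeight hX0 w)
  simp only [perronWeight_zero, mul_one] at key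
  have hleft := norm_integral_perronWeight_le (x := -η) (c := η) hX0 hV0.le hM hη
    (by rw [abs_neg]; exact le_abs_self _) (G := G)
    (fun y hy => hGM _ (by simp) (by simp; linarith) (by simpa using abs_le.mpr hy))
  -- On the horizontal sides -1 ≤ x ≤ 2, so x² ≤ 4 and the length is at most 3; the Gaussian then
  -- supplies the factor exp(4 - V²).
  have hhor : ∀ v : ℝ, |v| = V →
      ‖∫ x in (-η)..2, G (x + v * I) * perronWeight X (x + v * I) * ((x : ℂ) + v * I)⁻¹‖ ≤
        3 * (M * X ^ 2 * Real.exp (4 - V ^ 2)) := by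
    intro v hv
    have hv2 : v ^ 2 = V ^ 2 := by rw [← sq_abs, hv]
    have : ∀ x ∈ uIoc (-η) 2, ‖G (x + v * I) * perronWeight X (x + v * I) * ((x : ℂ) + v * I)⁻¹‖ ≤
        M * X ^ 2 * Real.exp (4 - V ^ 2) := by
      intro x hx
      rw [uIoc_of_le (by linarith)] at hx
      rw [norm_mul, norm_mul, norm_perronWeight hX0, norm_inv, hv2]
      have h1 : 1 ≤ ‖(x : ℂ) + v * I‖ := by
        refine hV.trans ?_
        rw [← hv]
        simpa using abs_im_le_norm ((x : ℂ) + v * I)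
      have h2 : ‖G (x + v * I)‖ ≤ M :=
        hGM _ (by simpa using hx.1.le) (by simpa using hx.2) (by simpa using hv.le)
      have h3 : X ^ x ≤ X ^ 2 := by
        rw [← Real.rpow_two]; exact Real.rpow_le_rpow_of_exponent_le hX hx.2
      have h4 : Real.exp (x ^ 2) * Real.exp (-V ^ 2) ≤ Real.exp (4 - V ^ 2) := by
        rw [← Real.exp_add, Real.exp_le_exp]
        nlinarith [hx.1, hx.2]
      calc _ ≤ M * (X ^ 2 * Real.exp (4 - V ^ 2)) * 1 := by
            gcongr
            exact inv_le_one_of_one_le₀ h1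
        _ = _ := by ring
    refine (intervalIntegral.norm_integral_le_of_norm_le_const this).trans ?_
    rw [mul_comm, abs_of_nonneg (by linarith)]
    gcongr
    linarith
  have hb := hhor (-V) (by rw [abs_neg, abs_of_pos hV0])
  have ht := hhor V (abs_of_pos hV0)
  set A := ∫ x in (-η)..2, G (x + (-V : ℝ) * I) * perronWeight X (x + (-V : ℝ) * I) *
    ((x : ℂ) + (-V : ℝ) * I)⁻¹ with hA
  set B := ∫ x in (-η)..2, G (x + V * I) * perronWeight X (x + V * I) * ((x : ℂ) + V * I)⁻¹ with hB
  set D := ∫ y in (-V)..V, G ((-η : ℝ) + y * I) * perronWeight X ((-η : ℝ) + y * I) *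
    (((-η : ℝ) : ℂ) + y * I)⁻¹ with hD
  have hpi : (Real.pi : ℂ) ≠ 0 := by exact_mod_cast Real.pi_ne_zero
  have heq : G 0 - perronAvg X V G = (1 / (2 * Real.pi) : ℝ) * (-I * (A - B) - D) := by
    unfold perronAvg
    set P := ∫ y in (-V)..V, G ((2 : ℝ) + y * I) * perronWeight X ((2 : ℝ) + y * I) *
      (((2 : ℝ) : ℂ) + y * I)⁻¹ with hP
    clear_value A B D P
    push_cast
    field_simp
    linear_combination I * key + (2 * G 0 * Real.pi - P + D) * I_sq
  rw [heq, norm_mul, norm_real, Real.norm_of_nonneg (by positivity)]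
  have hpi3 := Real.pi_gt_three
  have hpos : 0 ≤ M * X ^ 2 * Real.exp (4 - V ^ 2) := by positivity
  have hexp : Real.exp ((-η) ^ 2) ≤ 3 := by
    calc Real.exp ((-η) ^ 2) ≤ Real.exp 1 := by rw [Real.exp_le_exp]; nlinarith
      _ ≤ 3 := by linarith [Real.exp_one_lt_d9]
  calc _ ≤ 1 / (2 * Real.pi) * ((3 * (M * X ^ 2 * Real.exp (4 - V ^ 2)) +
          3 * (M * X ^ 2 * Real.exp (4 - V ^ 2))) + M * X ^ (-η) * 3 * η⁻¹ * Real.pi) := by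
        gcongr
        refine (norm_sub_le _ _).trans (add_le_add ?_ (hleft.trans (by gcongr)))
        rw [norm_mul, norm_neg, norm_I, one_mul]
        exact (norm_sub_le _ _).trans (add_le_add hb ht)
    _ = 3 / Real.pi * (M * X ^ 2 * Real.exp (4 - V ^ 2)) + 3 / 2 * (M * X ^ (-η) * η⁻¹) := by
        field_simp; ring
    _ ≤ 1 * (M * X ^ 2 * Real.exp (4 - V ^ 2)) + 2 * (M * X ^ (-η) * η⁻¹) := by
        gcongr
        · rw [div_le_one Real.pi_pos]; exact hpi3.le
        · norm_num
    _ = _ := by unfold perronError; ring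

end SmoothedPerron

/-! ### Mean square of a Dirichlet polynomial -/

section MeanValue
open Complex ComplexConjugate

/-- The oscillation `n ^ (-it)`. -/
noncomputable def natOsc (n : ℕ) (t : ℝ) : ℂ := exp ((-Real.log n : ℝ) * I * t)

lemma continuous_natOsc (n : ℕ) : Continuous (natOsc n) := by
  unfold natOsc; fun_prop

/-- Distinct integers up to N have logarithms at least 1/N apart, and an oscillation of frequency l
integrates to at most 2/|l|. -/
lemma norm_integral_natOsc_le {N m n : ℕ} (hm : m ∈ Finset.Icc 1 N) (hn : n ∈ Finset.Icc 1 N)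
    (hmn : m ≠ n) (T : ℝ) :
    ‖∫ t in T..(2 * T), natOsc m t * conj (natOsc n t)‖ ≤ 2 * N := by
  rw [Finset.mem_Icc] at hm hn
  have hlog : ∀ a b : ℕ, 1 ≤ a → a < b → b ≤ N → 1 / (N : ℝ) ≤ Real.log b - Real.log a := by
    intro a b ha hab hb
    have ha0 : (0 : ℝ) < a := by exact_mod_cast ha
    have hb0 : (0 : ℝ) < b := by exact_mod_cast ha.trans hab.le
    have hN0 : (0 : ℝ) < N := by exact_mod_cast (ha.trans hab.le).trans hb
    have h := Real.log_le_sub_one_of_pos (div_pos ha0 hb0)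
    rw [Real.log_div ha0.ne' hb0.ne'] at h
    have h1 : (a : ℝ) + 1 ≤ b := by exact_mod_cast hab
    have h2 : (b : ℝ) ≤ N := by exact_mod_cast hb
    have h3 : (a : ℝ) / b ≤ 1 - 1 / N := by
      rw [div_le_iff₀ hb0]
      have : (1 / N : ℝ) * b ≤ 1 := by rw [one_div_mul_eq_div, div_le_one hN0]; exact h2
      linarith
    linarith
  set l : ℝ := Real.log n - Real.log m with hl
  have hN0 : (0 : ℝ) < N := by exact_mod_cast hm.1.trans hm.2
  have hlabs : 1 / (N : ℝ) ≤ |l| := by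
    rcases lt_or_gt_of_ne hmn with h | h
    · exact (hlog m n hm.1 h hn.2).trans (le_abs_self _)
    · refine (hlog n m hn.1 h hm.2).trans ?_
      rw [hl, abs_sub_comm]; exact le_abs_self _
  have hl0 : l ≠ 0 := by
    intro h; rw [h, abs_zero] at hlabs
    have : 0 < 1 / (N : ℝ) := by positivity
    linarith
  have he : ∀ t : ℝ, natOsc m t * conj (natOsc n t) = exp ((l * I : ℂ) * t) := by
    intro t
    unfold natOsc
    rw [← exp_conj, ← exp_add, hl]
    congr 1
    simp only [map_mul, conj_ofReal, conj_I]
    push_cast; ring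
  simp_rw [he]
  have hc : (l * I : ℂ) ≠ 0 := mul_ne_zero (by exact_mod_cast hl0) I_ne_zero
  rw [integral_exp_mul_complex hc, norm_div, norm_mul, norm_I, mul_one, norm_real, Real.norm_eq_abs,
    div_le_iff₀ (abs_pos.mpr hl0)]
  have hn1 : ∀ x : ℝ, ‖exp ((l * I : ℂ) * x)‖ = 1 := fun x => by
    rw [show (l * I : ℂ) * x = ((l * x : ℝ) : ℂ) * I by push_cast; ring, norm_exp_ofReal_mul_I]
  calc _ ≤ ‖exp ((l * I : ℂ) * ((2 * T : ℝ) : ℂ))‖ + ‖exp ((l * I : ℂ) * T)‖ := norm_sub_le _ _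
    _ = 2 * N * (1 / N) := by rw [hn1, hn1]; field_simp; norm_num
    _ ≤ _ := by gcongr

lemma integral_natOsc_self (n : ℕ) (T : ℝ) :
    ∫ t in T..(2 * T), natOsc n t * conj (natOsc n t) = (T : ℂ) := by
  have : ∀ t : ℝ, natOsc n t * conj (natOsc n t) = 1 := fun t => by
    rw [mul_conj, normSq_eq_norm_sq]
    unfold natOsc
    rw [show ((-Real.log n : ℝ) : ℂ) * I * t = ((-Real.log n * t : ℝ) : ℂ) * I by push_cast; ring,
      norm_exp_ofReal_mul_I]
    simp
  simp_rw [this]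
  simp; ring

/-- A mean value theorem for Dirichlet polynomials. -/
lemma abs_meanSquare_sub_le (a : ℕ → ℂ) (N : ℕ) {T : ℝ} (hT : 0 < T) :
    |(1 / T) * (∫ t in T..(2 * T), ‖∑ n ∈ Finset.Icc 1 N, a n * natOsc n t‖ ^ 2) -
      ∑ n ∈ Finset.Icc 1 N, ‖a n‖ ^ 2| ≤ 2 * N ^ 2 / T * ∑ n ∈ Finset.Icc 1 N, ‖a n‖ ^ 2 := by
  set s := Finset.Icc 1 N with hs
  set Q := ∑ n ∈ s, ‖a n‖ ^ 2 with hQ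
  set J : ℕ → ℕ → ℂ := fun m n => ∫ t in T..(2 * T), natOsc m t * conj (natOsc n t) with hJ
  have hint : ((∫ t in T..(2 * T), ‖∑ n ∈ s, a n * natOsc n t‖ ^ 2 : ℝ) : ℂ) =
      ∑ m ∈ s, ∑ n ∈ s, a m * conj (a n) * J m n := by
    rw [← intervalIntegral.integral_ofReal]
    have h1 : ∀ t : ℝ, ((‖∑ n ∈ s, a n * natOsc n t‖ ^ 2 : ℝ) : ℂ) =
        ∑ m ∈ s, ∑ n ∈ s, a m * conj (a n) * (natOsc m t * conj (natOsc n t)) := by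
      intro t
      rw [← normSq_eq_norm_sq, ← mul_conj, map_sum, Finset.sum_mul_sum]
      refine Finset.sum_congr rfl fun m _ => Finset.sum_congr rfl fun n _ => ?_
      rw [map_mul]; ring
    have hc : ∀ m n : ℕ, Continuous fun t : ℝ => a m * conj (a n) * (natOsc m t * conj (natOsc n t)) :=
      fun m n => continuous_const.mul
        ((continuous_natOsc m).mul (continuous_conj.comp (continuous_natOsc n)))
    simp_rw [h1]
    rw [intervalIntegral.integral_finsetSum fun m _ =>
      (continuous_finsetSum _ fun n _ => hc m n).intervalIntegrable _ _]
    refine Finset.sum_congr rfl fun m _ => ?_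
    rw [intervalIntegral.integral_finsetSum fun n _ => (hc m n).intervalIntegrable _ _]
    refine Finset.sum_congr rfl fun n _ => ?_
    rw [intervalIntegral.integral_const_mul]
  have hdiag : ((T * Q : ℝ) : ℂ) = ∑ m ∈ s, ∑ n ∈ s, a m * conj (a n) * (if m = n then (T : ℂ) else 0) := by
    rw [hQ]; push_cast; rw [Finset.mul_sum]
    refine Finset.sum_congr rfl fun m hm => ?_
    simp only [mul_ite, mul_zero]
    rw [Finset.sum_ite_eq s m, if_pos hm, mul_conj, normSq_eq_norm_sq]
    push_cast; ring
  have hdiff : |(∫ t in T..(2 * T), ‖∑ n ∈ s, a n * natOsc n t‖ ^ 2) - T * Q| ≤ 2 * N ^ 2 * Q := by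
    rw [← Real.norm_eq_abs, ← norm_real, ofReal_sub, hint, hdiag, ← Finset.sum_sub_distrib]
    simp_rw [← Finset.sum_sub_distrib, ← mul_sub]
    calc _ ≤ ∑ m ∈ s, ∑ n ∈ s, ‖a m‖ * ‖a n‖ * (2 * N) := by
          refine norm_sum_le_of_le _ fun m hm => norm_sum_le_of_le _ fun n hn => ?_
          rw [norm_mul, norm_mul, norm_conj]
          gcongr
          by_cases h : m = n
          · subst h
            rw [if_pos rfl, hJ]; simp only [integral_natOsc_self, sub_self, norm_zero]; positivity
          · rw [if_neg h, sub_zero]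
            exact norm_integral_natOsc_le hm hn h T
      _ = (∑ n ∈ s, ‖a n‖) ^ 2 * (2 * N) := by
          rw [sq, Finset.sum_mul_sum, Finset.sum_mul]
          refine Finset.sum_congr rfl fun m _ => ?_
          rw [Finset.sum_mul]
      -- Cauchy–Schwarz on the N coefficients; the resulting N² is harmless since N will be about
      -- T^{1/4}.
      _ ≤ (N * Q) * (2 * N) := by
          gcongr
          have := sq_sum_le_card_mul_sum_sq (s := s) (f := fun n => ‖a n‖)
          simpa [hs] using this
      _ = _ := by ring
  have : (1 / T) * (∫ t in T..(2 * T), ‖∑ n ∈ s, a n * natOsc n t‖ ^ 2) - Q =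
      (1 / T) * ((∫ t in T..(2 * T), ‖∑ n ∈ s, a n * natOsc n t‖ ^ 2) - T * Q) := by
    field_simp
  rw [this, abs_mul, abs_of_pos (by positivity)]
  calc _ ≤ 1 / T * (2 * N ^ 2 * Q) := by gcongr
    _ = _ := by ring

end MeanValue

/-! ### Approximating ζ^k by a Dirichlet polynomial -/

section Approximation
open Complex

lemma continuous_perron_kernel {X : ℝ} (hX : 0 < X) :
    Continuous fun y : ℝ => perronWeight X ((2 : ℝ) + y * I) * (((2 : ℝ) : ℂ) + y * I)⁻¹ :=
  ((differentiable_perronWeight hX).continuous.comp (by fun_prop)).mul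
    (Continuous.inv₀ (by fun_prop) two_add_mul_I_ne_zero)

lemma perronAvg_sub {X V : ℝ} (hX : 0 < X) {F G : ℂ → ℂ}
    (hF : Continuous fun y : ℝ => F ((2 : ℝ) + y * I))
    (hG : Continuous fun y : ℝ => G ((2 : ℝ) + y * I)) :
    perronAvg X V (fun w => F w - G w) = perronAvg X V F - perronAvg X V G := by
  unfold perronAvg
  rw [← mul_sub]
  simp_rw [mul_assoc]
  have h : ∀ {H : ℂ → ℂ}, (Continuous fun y : ℝ => H ((2 : ℝ) + y * I)) →
      Continuous fun y : ℝ => H ((2 : ℝ) + y * I) *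
        (perronWeight X ((2 : ℝ) + y * I) * (((2 : ℝ) : ℂ) + y * I)⁻¹) :=
    fun hH => hH.mul (continuous_perron_kernel hX)
  rw [← intervalIntegral.integral_sub ((h hF).intervalIntegrable _ _)
    ((h hG).intervalIntegrable _ _)]
  simp_rw [sub_mul]

lemma perronAvg_sum {X V : ℝ} (hX : 0 < X) (s : Finset ℕ) (c : ℕ → ℂ) {g : ℕ → ℂ → ℂ}
    (hg : ∀ n ∈ s, Continuous fun y : ℝ => g n ((2 : ℝ) + y * I)) :
    perronAvg X V (fun w => ∑ n ∈ s, c n * g n w) = ∑ n ∈ s, c n * perronAvg X V (g n) := by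
  unfold perronAvg
  have h : ∀ n ∈ s, Continuous fun y : ℝ => c n * (g n ((2 : ℝ) + y * I) *
      (perronWeight X ((2 : ℝ) + y * I) * (((2 : ℝ) : ℂ) + y * I)⁻¹)) := fun n hn =>
    continuous_const.mul ((hg n hn).mul (continuous_perron_kernel hX))
  simp_rw [Finset.sum_mul, mul_assoc]
  rw [intervalIntegral.integral_finsetSum fun n hn => (h n hn).intervalIntegrable _ _,
    Finset.mul_sum]
  refine Finset.sum_congr rfl fun n _ => ?_
  rw [intervalIntegral.integral_const_mul]; ring

/-- The smooth cut-off attached to `n` by the smoothed Perron formula. -/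
noncomputable def perronCutoff (X V : ℝ) (n : ℕ) : ℂ := perronAvg X V (fun w => (n : ℂ) ^ (-w))

/-- This is the shifted Perron formula for w ↦ n^{-w}, which is 1 at w = 0 and at most n^η in the
strip. The loss n^η is later repaid by measuring the diagonal at σ - η. -/
lemma norm_perronCutoff_sub_one_le {X V η : ℝ} (hX : 1 ≤ X) (hV : 1 ≤ V) (hη : 0 < η) (hη1 : η ≤ 1)
    {n : ℕ} (hn : 1 ≤ n) : ‖perronCutoff X V n - 1‖ ≤ (n : ℝ) ^ η * perronError X V η := by
  have hn0 : (n : ℂ) ≠ 0 := by exact_mod_cast (by omega : n ≠ 0)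
  have h := norm_sub_perronAvg_le (M := (n : ℝ) ^ η) hX hV hη hη1 (G := fun w => (n : ℂ) ^ (-w))
    (fun w _ _ _ => DifferentiableAt.const_cpow differentiableAt_id.neg (Or.inl hn0))
    (fun w hw _ _ => by
      rw [norm_natCast_cpow_of_pos (by omega), neg_re]
      exact Real.rpow_le_rpow_of_exponent_le (by exact_mod_cast hn) (by linarith))
  rw [norm_sub_rev]
  simpa [perronCutoff] using h

/-- The partial sum of the Dirichlet series of `ζ ^ k` and a Rankin bound for its tail. -/
lemma norm_zeta_pow_sub_sum_le {σ : ℝ} (hσ : 0 < σ) (k : ℕ) {N : ℕ} (hN : 1 ≤ N) {s : ℂ}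
    (hs : s.re = σ + 2) :
    ‖riemannZeta s ^ k - ∑ n ∈ Finset.Icc 1 N, (divisorFun k n : ℂ) * (n : ℂ) ^ (-s)‖ ≤
      ‖riemannZeta ((1 + σ : ℝ) : ℂ)‖ ^ k / N := by
  have hre1 : ((1 + σ : ℝ) : ℂ).re = 1 + σ := ofReal_re _
  have h1 := LSeriesHasSum_divisorFun k (s := ((1 + σ : ℝ) : ℂ)) (by rw [hre1]; linarith)
  have h2 := LSeriesHasSum_divisorFun k (s := s) (by rw [hs]; linarith)
  unfold LSeriesHasSum at h1 h2
  have hterm1 : ∀ n : ℕ, LSeries.term (fun n => (divisorFun k n : ℂ)) ((1 + σ : ℝ) : ℂ) n =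
      ((divisorFun k n * (n : ℝ) ^ (-(1 + σ)) : ℝ) : ℂ) := by
    intro n
    rcases Nat.eq_zero_or_pos n with rfl | hn
    · simp [divisorFun_zero_right]
    · rw [LSeries.term_of_ne_zero hn.ne', div_eq_mul_inv, ← cpow_neg]
      push_cast
      rw [ofReal_cpow (by positivity)]
      push_cast; rfl
  have hsum1 : HasSum (fun n : ℕ => (divisorFun k n : ℝ) * (n : ℝ) ^ (-(1 + σ)))
      (riemannZeta ((1 + σ : ℝ) : ℂ) ^ k).re := by
    have := hasSum_re h1
    simpa only [hterm1, ofReal_re] using this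
  have hterm2 : ∀ n : ℕ, LSeries.term (fun n => (divisorFun k n : ℂ)) s n =
      (divisorFun k n : ℂ) * (n : ℂ) ^ (-s) := by
    intro n
    rcases Nat.eq_zero_or_pos n with rfl | hn
    · simp [divisorFun_zero_right]
    · rw [LSeries.term_of_ne_zero hn.ne', div_eq_mul_inv, ← cpow_neg]
  simp only [funext hterm2] at h2
  have h3 : HasSum (fun n => if n ∈ Finset.Icc 1 N then (divisorFun k n : ℂ) * (n : ℂ) ^ (-s) else 0)
      (∑ n ∈ Finset.Icc 1 N, (divisorFun k n : ℂ) * (n : ℂ) ^ (-s)) := by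
    have := hasSum_sum_of_ne_finset_zero (L := SummationFilter.unconditional ℕ) (s := Finset.Icc 1 N)
      (f := fun n => if n ∈ Finset.Icc 1 N then (divisorFun k n : ℂ) * (n : ℂ) ^ (-s) else 0)
      (fun n hn => if_neg hn)
    rwa [Finset.sum_congr rfl fun n hn => if_pos hn] at this
  have h4 := h2.sub h3
  rw [← h4.tsum_eq]
  have hN0 : (0 : ℝ) < N := by exact_mod_cast hN
  refine (tsum_of_norm_bounded (hsum1.div_const (N : ℝ)) fun n => ?_).trans ?_
  · by_cases hn : n ∈ Finset.Icc 1 N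
    · simp only [if_pos hn, sub_self, norm_zero]; positivity
    · rw [if_neg hn, sub_zero]
      rcases Nat.eq_zero_or_pos n with rfl | hn0
      · simp [divisorFun_zero_right]
      · have hnN : N ≤ n := by
          rw [Finset.mem_Icc] at hn; omega
        have hn1 : (0 : ℝ) < n := by exact_mod_cast hn0
        -- Rankin's trick: for n > N one of the two spare powers of n is exchanged for 1/N, and the
        -- other keeps the series convergent.
        rw [norm_mul, norm_natCast_cpow_of_pos hn0, neg_re, hs, Complex.norm_natCast,
          show -(σ + 2) = -(1 + σ) - 1 by ring, Real.rpow_sub hn1, Real.rpow_one, mul_div_assoc]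
        have : (N : ℝ) ≤ n := by exact_mod_cast hnN
        gcongr
  · gcongr
    rw [← norm_pow]
    exact re_le_norm _

/-- The coefficients of the Dirichlet polynomial approximating `ζ(σ + it) ^ k`. -/
noncomputable def approxCoeff (σ X V : ℝ) (k n : ℕ) : ℂ :=
  ((divisorFun k n * (n : ℝ) ^ (-σ) : ℝ) : ℂ) * perronCutoff X V n

/-- Approximation of `ζ(σ + it) ^ k` by a Dirichlet polynomial. -/
lemma norm_zeta_pow_sub_dirichletPoly_le {σ X V η M T : ℝ} {k N : ℕ} (hσ : 0 < σ) (hX : 1 ≤ X)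
    (hV : 1 ≤ V) (hη : 0 < η) (hη1 : η ≤ 1) (hN : 1 ≤ N) (hVT : V < T)
    (hM : ∀ u v : ℝ, σ - η ≤ u → T - V ≤ v → v ≤ 2 * T + V → ‖riemannZeta (u + v * I)‖ ^ k ≤ M)
    {t : ℝ} (ht : t ∈ Icc T (2 * T)) :
    ‖riemannZeta (σ + t * I) ^ k - ∑ n ∈ Finset.Icc 1 N, approxCoeff σ X V k n * natOsc n t‖ ≤
      M * perronError X V η + ‖riemannZeta ((1 + σ : ℝ) : ℂ)‖ ^ k / N * X ^ 2 * Real.exp 4 := by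
  have hX0 : 0 < X := by linarith
  set s : ℂ := σ + t * I with hs
  have hsre : s.re = σ := by simp [hs]
  have hsim : s.im = t := by simp [hs]
  set F : ℂ → ℂ := fun w => riemannZeta (s + w) ^ k with hF
  have hne : ∀ w : ℂ, |w.im| ≤ V → s + w ≠ 1 := by
    intro w hw h
    have := congrArg Complex.im h
    rw [add_im, hsim, one_im] at this
    have := (abs_le.mp hw).1
    linarith [ht.1]
  have hA := norm_sub_perronAvg_le (M := M) hX hV hη hη1 (G := F)
    (fun w _ _ hw => by
      have : DifferentiableAt ℂ (fun w => riemannZeta (s + w)) w :=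
        DifferentiableAt.fun_comp' (f := fun w => s + w) (g := riemannZeta) w
          (differentiableAt_riemannZeta (hne w hw)) (by fun_prop)
      exact this.pow k)
    (fun w hw _ hwV => by
      have hw' := abs_le.mp hwV
      have := hM (σ + w.re) (t + w.im) (by linarith) (by linarith [ht.1]) (by linarith [ht.2])
      simp only [hF, norm_pow]
      have e : s + w = ((σ + w.re : ℝ) : ℂ) + ((t + w.im : ℝ) : ℂ) * I := by
        apply Complex.ext <;> simp [hs]
      rwa [e])
  have hline1 : ∀ y : ℝ, s + ((2 : ℝ) + y * I) ≠ 1 := fun y h => by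
    have := congrArg Complex.re h
    simp [hsre] at this
    linarith
  have hcF : Continuous fun y : ℝ => F ((2 : ℝ) + y * I) := by
    refine Continuous.pow ?_ k
    rw [continuous_iff_continuousAt]
    intro y
    exact ContinuousAt.comp (f := fun y : ℝ => s + ((2 : ℝ) + y * I)) (g := riemannZeta)
      (differentiableAt_riemannZeta (hline1 y)).continuousAt (by fun_prop)
  -- On the line Re w = 2 the Dirichlet series converges absolutely, so there the first N terms can
  -- replace ζ^k inside the Perron integral.
  set P : ℂ → ℂ := fun w => ∑ n ∈ Finset.Icc 1 N,
    ((divisorFun k n : ℂ) * (n : ℂ) ^ (-s)) * (n : ℂ) ^ (-w) with hP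
  have hcg : ∀ n ∈ Finset.Icc 1 N, Continuous fun y : ℝ => (n : ℂ) ^ (-(((2 : ℝ) : ℂ) + y * I)) := by
    intro n hn
    rw [Finset.mem_Icc] at hn
    have : (n : ℂ) ≠ 0 := by exact_mod_cast (by omega : n ≠ 0)
    exact Continuous.const_cpow (by fun_prop) (Or.inl this)
  have hcP : Continuous fun y : ℝ => P ((2 : ℝ) + y * I) :=
    continuous_finsetSum _ fun n hn => continuous_const.mul (hcg n hn)
  have hPsum : perronAvg X V P = ∑ n ∈ Finset.Icc 1 N, approxCoeff σ X V k n * natOsc n t := by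
    rw [hP, perronAvg_sum hX0 _ _ (g := fun n w => (n : ℂ) ^ (-w)) hcg]
    refine Finset.sum_congr rfl fun n hn => ?_
    rw [Finset.mem_Icc] at hn
    have hn0 : (n : ℂ) ≠ 0 := by exact_mod_cast (by omega : n ≠ 0)
    have e : (n : ℂ) ^ (-s) = (((n : ℝ) ^ (-σ) : ℝ) : ℂ) * natOsc n t := by
      rw [hs, neg_add, cpow_add _ _ hn0, ofReal_cpow (by positivity)]
      congr 1
      · push_cast; rfl
      · rw [cpow_def_of_ne_zero hn0, natOsc, ← natCast_log]
        congr 1; push_cast; ring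
    rw [e]
    unfold approxCoeff perronCutoff
    push_cast; ring
  have hB : ‖perronAvg X V F - perronAvg X V P‖ ≤
      ‖riemannZeta ((1 + σ : ℝ) : ℂ)‖ ^ k / N * X ^ 2 * Real.exp 4 := by
    rw [← perronAvg_sub hX0 hcF hcP]
    refine norm_perronAvg_le hX0 (by linarith) (by positivity) fun y _ => ?_
    have h := norm_zeta_pow_sub_sum_le hσ k hN (s := s + ((2 : ℝ) + y * I)) (by simp [hsre])
    convert h using 3
    refine Finset.sum_congr rfl fun n hn => ?_
    rw [Finset.mem_Icc] at hn
    have hn0 : (n : ℂ) ≠ 0 := by exact_mod_cast (by omega : n ≠ 0)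
    rw [neg_add s, cpow_add _ _ hn0]; ring
  rw [hPsum] at hB
  have : F 0 = riemannZeta s ^ k := by simp [hF]
  rw [this] at hA
  calc _ = ‖(riemannZeta s ^ k - perronAvg X V F) + (perronAvg X V F -
        ∑ n ∈ Finset.Icc 1 N, approxCoeff σ X V k n * natOsc n t)‖ := by congr 1; ring
    _ ≤ _ := (norm_add_le _ _).trans (add_le_add hA hB)

end Approximation

/-! ### Comparing the moment with the diagonal -/

section Moments
open Complex

lemma sigma_add_mul_I_ne_one {σ t : ℝ} (ht : t ≠ 0) : (σ : ℂ) + t * I ≠ 1 := fun h => by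
  apply ht; simpa using congrArg Complex.im h

lemma continuousOn_zeta_line (σ : ℝ) {T : ℝ} (hT : 0 < T) :
    ContinuousOn (fun t : ℝ => riemannZeta ((σ : ℂ) + t * I)) (Icc T (2 * T)) := fun t ht =>
  (ContinuousAt.comp (f := fun t : ℝ => (σ : ℂ) + t * I) (g := riemannZeta)
    (differentiableAt_riemannZeta (sigma_add_mul_I_ne_one (by linarith [ht.1]))).continuousAt
    (by fun_prop)).continuousWithinAt

lemma intervalIntegrable_zeta_pow (σ : ℝ) {T : ℝ} (hT : 0 < T) (m : ℕ) :
    IntervalIntegrable (fun t : ℝ => ‖riemannZeta ((σ : ℂ) + t * I)‖ ^ m) volume T (2 * T) := by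
  apply ContinuousOn.intervalIntegrable
  rw [uIcc_of_le (by linarith)]
  exact (continuousOn_zeta_line σ hT).norm.pow m

lemma divisorTerm_sub {σ η : ℝ} (k n : ℕ) :
    divisorTerm σ k n = divisorTerm (σ - η) k n * (n : ℝ) ^ (-(2 * η)) := by
  rcases Nat.eq_zero_or_pos n with rfl | hn
  · simp [divisorTerm_zero]
  · have hn0 : (0 : ℝ) < n := by exact_mod_cast hn
    unfold divisorTerm
    rw [div_mul_eq_mul_div, div_eq_div_iff (by positivity) (by positivity), mul_assoc,
      ← Real.rpow_add hn0]
    congr 2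
    ring

/-- The diagonal of the approximating Dirichlet polynomial is close to `divisorSum`. -/
lemma abs_sum_approxCoeff_sub_le {σ X V η : ℝ} {k N : ℕ} (hk : 1 ≤ k) (hX : 1 ≤ X) (hV : 1 ≤ V)
    (hη : 0 < η) (hη1 : η ≤ 1) (hN : 1 ≤ N) (hσ : 1 / 2 < σ - η) (hσ1 : σ < 1) :
    |divisorSum σ k - ∑ n ∈ Finset.Icc 1 N, ‖approxCoeff σ X V k n‖ ^ 2| ≤
      (2 * perronError X V η + perronError X V η ^ 2 + (N : ℝ) ^ (-(2 * η))) *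
        divisorSum (σ - η) k := by
  set τ := perronError X V η with hτ
  have hτ0 : 0 ≤ τ := by rw [hτ]; unfold perronError; positivity
  have hN0 : (0 : ℝ) < N := by exact_mod_cast hN
  have hS : HasSum (divisorTerm σ k) (divisorSum σ k) :=
    (summable_divisorTerm (by linarith) hσ1 hk).hasSum
  have hS' : HasSum (divisorTerm (σ - η) k) (divisorSum (σ - η) k) :=
    (summable_divisorTerm hσ (by linarith) hk).hasSum
  have h3 : HasSum (fun n => if n ∈ Finset.Icc 1 N then ‖approxCoeff σ X V k n‖ ^ 2 else 0)
      (∑ n ∈ Finset.Icc 1 N, ‖approxCoeff σ X V k n‖ ^ 2) := by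
    have := hasSum_sum_of_ne_finset_zero (L := SummationFilter.unconditional ℕ)
      (s := Finset.Icc 1 N)
      (f := fun n => if n ∈ Finset.Icc 1 N then ‖approxCoeff σ X V k n‖ ^ 2 else 0)
      (fun n hn => if_neg hn)
    rwa [Finset.sum_congr rfl fun n hn => if_pos hn] at this
  have h4 := hS.sub h3
  rw [← h4.tsum_eq, ← Real.norm_eq_abs]
  refine tsum_of_norm_bounded (hS'.mul_left _) fun n => ?_
  have hd0 := divisorTerm_nonneg (σ - η) k n
  have hNη : 0 ≤ (N : ℝ) ^ (-(2 * η)) := by positivity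
  rw [Real.norm_eq_abs, divisorTerm_sub (σ := σ) (η := η)]
  by_cases hn : n ∈ Finset.Icc 1 N
  · rw [if_pos hn]
    rw [Finset.mem_Icc] at hn
    have hn0 : (0 : ℝ) < n := by exact_mod_cast hn.1
    have ha : ‖approxCoeff σ X V k n‖ ^ 2 =
        divisorTerm (σ - η) k n * (n : ℝ) ^ (-(2 * η)) * ‖perronCutoff X V n‖ ^ 2 := by
      rw [← divisorTerm_sub]
      unfold approxCoeff divisorTerm
      rw [norm_mul, norm_real, Real.norm_of_nonneg (by positivity), mul_pow, mul_pow,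
        div_eq_mul_inv, ← Real.rpow_neg hn0.le, ← Real.rpow_natCast _ 2, ← Real.rpow_natCast _ 2,
        ← Real.rpow_mul hn0.le]
      congr 3
      push_cast; ring
    rw [ha, ← mul_one_sub, abs_mul, abs_of_nonneg (by positivity)]
    set b := (n : ℝ) ^ η with hb
    have hb1 : 1 ≤ b := Real.one_le_rpow (by exact_mod_cast hn.1) hη.le
    -- The factor gained by moving from σ to σ - η cancels exactly the squared loss of the cut-off
    -- estimate, uniformly in n.
    have hnb : (n : ℝ) ^ (-(2 * η)) * b ^ 2 = 1 := by
      rw [hb, ← Real.rpow_natCast, ← Real.rpow_mul hn0.le, ← Real.rpow_add hn0]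
      rw [show -(2 * η) + η * ((2 : ℕ) : ℝ) = 0 by push_cast; ring, Real.rpow_zero]
    have hW := norm_perronCutoff_sub_one_le hX hV hη hη1 hn.1
    rw [← hb, ← hτ] at hW
    set W := perronCutoff X V n
    have hW2 : |1 - ‖W‖ ^ 2| ≤ b ^ 2 * (2 * τ + τ ^ 2) := by
      have h1 : |‖W‖ - 1| ≤ b * τ := by
        refine le_trans ?_ hW
        simpa using abs_norm_sub_norm_le W 1
      have h2 : |1 - ‖W‖ ^ 2| = |‖W‖ - 1| * (‖W‖ + 1) := by
        rw [abs_sub_comm, show ‖W‖ ^ 2 - 1 = (‖W‖ - 1) * (‖W‖ + 1) by ring, abs_mul,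
          abs_of_nonneg (show 0 ≤ ‖W‖ + 1 by positivity)]
      have h3 : ‖W‖ + 1 ≤ b * τ + 2 := by linarith [(abs_le.mp h1).2]
      rw [h2]
      calc _ ≤ b * τ * (b * τ + 2) := by gcongr
        _ = b ^ 2 * τ ^ 2 + b * (2 * τ) := by ring
        _ ≤ b ^ 2 * τ ^ 2 + b ^ 2 * (2 * τ) := by gcongr; nlinarith
        _ = _ := by ring
    calc _ ≤ divisorTerm (σ - η) k n * (n : ℝ) ^ (-(2 * η)) * (b ^ 2 * (2 * τ + τ ^ 2)) := by gcongr
      _ = (2 * τ + τ ^ 2) * divisorTerm (σ - η) k n * ((n : ℝ) ^ (-(2 * η)) * b ^ 2) := by ring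
      _ ≤ _ := by
          rw [hnb, mul_one]
          exact mul_le_mul_of_nonneg_right (by linarith) hd0
  · rw [if_neg hn, sub_zero, abs_of_nonneg (by positivity), mul_comm]
    rcases Nat.eq_zero_or_pos n with rfl | hn0
    · simp [divisorTerm_zero]
    · rw [Finset.mem_Icc] at hn
      have hnN : (N : ℝ) ≤ n := by exact_mod_cast (by omega : N ≤ n)
      gcongr
      calc (n : ℝ) ^ (-(2 * η)) ≤ (N : ℝ) ^ (-(2 * η)) :=
            Real.rpow_le_rpow_of_nonpos hN0 hnN (by linarith)
        _ ≤ _ := by nlinarith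

/-- Comparison of the moment with `divisorSum` under explicit error bounds. -/
lemma abs_zetaMoment_sub_divisorSum_le {σ X V η M T ε : ℝ} {k N : ℕ} (hk : 1 ≤ k) (hX : 1 ≤ X)
    (hV : 1 ≤ V) (hη : 0 < η) (hη1 : η ≤ 1) (hN : 1 ≤ N) (hσ : 1 / 2 < σ - η) (hσ1 : σ < 1)
    (hVT : V < T) (hε1 : ε ≤ 1)
    (hM : ∀ u v : ℝ, σ - η ≤ u → T - V ≤ v → v ≤ 2 * T + V → ‖riemannZeta (u + v * I)‖ ^ k ≤ M)
    (h1 : M * perronError X V η +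
      ‖riemannZeta ((1 + σ : ℝ) : ℂ)‖ ^ k / N * X ^ 2 * Real.exp 4 ≤ ε)
    (h2 : (2 * perronError X V η + perronError X V η ^ 2 + (N : ℝ) ^ (-(2 * η))) *
        divisorSum (σ - η) k ≤ ε)
    (h3 : 2 * (N : ℝ) ^ 2 / T ≤ ε) :
    |zetaMoment σ k T - divisorSum σ k| ≤ 9 * ε * divisorSum σ k := by
  have hT : 0 < T := by linarith
  have hε : 0 ≤ ε := le_trans (by positivity) h3
  have hS1 := one_le_divisorSum (σ := σ) (by linarith) hσ1 hk
  set S := divisorSum σ k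
  set D : ℝ → ℂ := fun t => ∑ n ∈ Finset.Icc 1 N, approxCoeff σ X V k n * natOsc n t with hD
  set Q := ∑ n ∈ Finset.Icc 1 N, ‖approxCoeff σ X V k n‖ ^ 2 with hQ
  set A := (1 / T) * ∫ t in T..(2 * T), ‖D t‖ ^ 2 with hA
  have hSQ : |S - Q| ≤ ε := (abs_sum_approxCoeff_sub_le hk hX hV hη hη1 hN hσ hσ1).trans h2
  have hQ0 : 0 ≤ Q := Finset.sum_nonneg fun n _ => by positivity
  have hAQ : |A - Q| ≤ ε * Q :=
    (abs_meanSquare_sub_le _ N hT).trans (mul_le_mul_of_nonneg_right h3 hQ0)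
  have hDc : Continuous fun t => ‖D t‖ ^ 2 :=
    (continuous_finsetSum _ fun n _ => continuous_const.mul (continuous_natOsc n)).norm.pow 2
  have hDi : IntervalIntegrable (fun t => ‖D t‖ ^ 2) volume T (2 * T) := hDc.intervalIntegrable _ _
  have hmA : |zetaMoment σ k T - A| ≤ ε * (A + 2) := by
    -- With ε ≤ 1 one has |z| + |D| ≤ 2|D| + 1 ≤ |D|² + 2, so the error is controlled by the mean
    -- square of D itself.
    have hpt : ∀ t ∈ Icc T (2 * T), |‖riemannZeta ((σ : ℂ) + t * I)‖ ^ (2 * k) - ‖D t‖ ^ 2| ≤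
        ε * (‖D t‖ ^ 2 + 2) := by
      intro t ht
      have h := (norm_zeta_pow_sub_dirichletPoly_le (by linarith) hX hV hη hη1 hN hVT hM ht).trans h1
      rw [mul_comm 2 k, pow_mul, ← norm_pow]
      set z := riemannZeta ((σ : ℂ) + t * I) ^ k
      have h' : |‖z‖ - ‖D t‖| ≤ ε := (abs_norm_sub_norm_le _ _).trans h
      rw [show ‖z‖ ^ 2 - ‖D t‖ ^ 2 = (‖z‖ - ‖D t‖) * (‖z‖ + ‖D t‖) by ring, abs_mul,
        abs_of_nonneg (show 0 ≤ ‖z‖ + ‖D t‖ by positivity)]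
      have h5 := (abs_le.mp h').2
      exact mul_le_mul h' (by nlinarith [sq_nonneg (‖D t‖ - 1)]) (by positivity) hε
    have hle : (2 * T) - T = T := by ring
    unfold zetaMoment
    rw [hA, ← mul_sub, ← intervalIntegral.integral_sub (intervalIntegrable_zeta_pow σ hT _) hDi,
      abs_mul, abs_of_pos (by positivity : 0 < 1 / T)]
    calc _ ≤ 1 / T * ∫ t in T..(2 * T), ε * (‖D t‖ ^ 2 + 2) := by
          gcongr
          rw [← Real.norm_eq_abs]
          refine intervalIntegral.norm_integral_le_of_norm_le (by linarith)
            (Eventually.of_forall fun t ht => hpt t (Ioc_subset_Icc_self ht)) ?_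
          exact (continuous_const.mul (hDc.add continuous_const)).intervalIntegrable _ _
      _ = _ := by
          rw [intervalIntegral.integral_const_mul, intervalIntegral.integral_add hDi (by simp),
            intervalIntegral.integral_const, hle]
          simp only [smul_eq_mul]
          field_simp
  -- The three comparisons cost ε, 2ε and 6ε times S, which is the source of the factor 9.
  have hQS : Q ≤ 2 * S := by linarith [(abs_le.mp hSQ).1]
  have hAS : A ≤ 4 * S := by nlinarith [(abs_le.mp hAQ).2]
  have e1 : |S - Q| ≤ ε * S := hSQ.trans (by nlinarith)
  have e2 : |A - Q| ≤ 2 * ε * S := hAQ.trans (by nlinarith)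
  have e3 : |zetaMoment σ k T - A| ≤ 6 * ε * S := hmA.trans (by nlinarith)
  rw [abs_le] at *
  constructor <;> linarith [e1.1, e1.2, e2.1, e2.2, e3.1, e3.2]

end Moments

/-! ### From moments to the maximum -/

section MaxBound
open Complex

/-- The supremum is meaningful only for a set bounded above, since `sSup` is 0 otherwise;
compactness of [T, 2T], away from the pole, gives the bound. -/
lemma log_norm_zeta_le_maxLogZeta {σ T t : ℝ} (hT : 0 < T) (ht : t ∈ Icc T (2 * T))
    (h0 : riemannZeta ((σ : ℂ) + t * I) ≠ 0) :
    Real.log ‖riemannZeta ((σ : ℂ) + t * I)‖ ≤ maxLogZeta T σ := by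
  refine le_csSup ?_ ⟨t, ⟨ht, h0⟩, rfl⟩
  obtain ⟨B, hB⟩ := isCompact_Icc.exists_bound_of_continuousOn (continuousOn_zeta_line σ hT)
  refine ⟨Real.log B, ?_⟩
  rintro _ ⟨u, ⟨hu, hu0⟩, rfl⟩
  exact Real.log_le_log (norm_pos_iff.mpr hu0) (hB u hu)

lemma norm_zeta_le_exp_maxLogZeta {σ T t : ℝ} (hT : 0 < T) (ht : t ∈ Icc T (2 * T)) :
    ‖riemannZeta ((σ : ℂ) + t * I)‖ ≤ Real.exp (maxLogZeta T σ) := by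
  by_cases h0 : riemannZeta ((σ : ℂ) + t * I) = 0
  · rw [h0, norm_zero]; positivity
  · rw [← Real.log_le_iff_le_exp (norm_pos_iff.mpr h0)]
    exact log_norm_zeta_le_maxLogZeta hT ht h0

/-- The maximum of `log |ζ|` is bounded below in terms of any moment. -/
lemma zetaMoment_le_exp_maxLogZeta {σ T : ℝ} (hT : 0 < T) (k : ℕ) :
    zetaMoment σ k T ≤ Real.exp (maxLogZeta T σ) ^ (2 * k) := by
  unfold zetaMoment
  calc _ ≤ 1 / T * ∫ t in T..(2 * T), Real.exp (maxLogZeta T σ) ^ (2 * k) := by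
        gcongr
        refine intervalIntegral.integral_mono_on (by linarith) (intervalIntegrable_zeta_pow σ hT _)
          (by simp) fun t ht => ?_
        gcongr
        exact norm_zeta_le_exp_maxLogZeta hT ht
    _ = _ := by
        rw [intervalIntegral.integral_const, smul_eq_mul]; field_simp; ring

/-- A large value of `ζ` on the line `Re s = σ` forces a large moment. -/
lemma pow_le_zetaMoment {σ T t : ℝ} (hσ : 1 / 2 ≤ σ) (hσ1 : σ ≤ 1) (hT : 2 ≤ T)
    (ht : t ∈ Icc T (2 * T)) (h1 : 1 ≤ ‖riemannZeta ((σ : ℂ) + t * I)‖) (k : ℕ) :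
    (‖riemannZeta ((σ : ℂ) + t * I)‖ / 2) ^ (2 * k) ≤ 200 * T ^ 2 * zetaMoment σ k T := by
  have hT0 : 0 < T := by linarith
  set m := ‖riemannZeta ((σ : ℂ) + t * I)‖ with hm
  -- With the Lipschitz constant 100T, ζ moves by at most 1/2 ≤ m/2 over a distance r.
  set r : ℝ := 1 / (200 * T) with hr
  have hr0 : 0 < r := by positivity
  have hrT : r ≤ T / 2 := by
    rw [hr, div_le_iff₀ (by positivity)]; nlinarith
  -- The interval of length r starts at t, or ends at t when it would pass 2T.
  obtain ⟨a, haT, haT2, hat⟩ : ∃ a, T ≤ a ∧ a + r ≤ 2 * T ∧ ∀ u ∈ Icc a (a + r), |u - t| ≤ r := by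
    by_cases h : t + r ≤ 2 * T
    · refine ⟨t, ht.1, h, fun u hu => ?_⟩
      rw [abs_le]; constructor <;> linarith [hu.1, hu.2]
    · refine ⟨t - r, by linarith, by linarith [ht.2], fun u hu => ?_⟩
      rw [abs_le]; constructor <;> linarith [hu.1, hu.2]
  have hlip : ∀ u ∈ Icc T (2 * T), ‖riemannZeta ((σ : ℂ) + u * I) - riemannZeta ((σ : ℂ) + t * I)‖ ≤
      100 * T * |u - t| := by
    intro u hu
    have hd : ∀ x ∈ Icc T (2 * T), HasDerivWithinAt (fun x : ℝ => riemannZeta ((σ : ℂ) + x * I))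
        (deriv riemannZeta ((σ : ℂ) + x * I) * I) (Icc T (2 * T)) x := by
      intro x hx
      have hx0 : x ≠ 0 := by linarith [hx.1]
      have h2 : HasDerivAt (fun x : ℝ => (σ : ℂ) + x * I) I x := by
        simpa using ((hasDerivAt_id x).ofReal_comp.mul_const I).const_add (σ : ℂ)
      exact ((differentiableAt_riemannZeta (sigma_add_mul_I_ne_one hx0)).hasDerivAt.comp x
        h2).hasDerivWithinAt
    have := (convex_Icc T (2 * T)).norm_image_sub_le_of_norm_hasDerivWithin_le (C := 100 * T) hd
      (fun x hx => by
        rw [norm_mul, norm_I, mul_one]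
        refine (norm_deriv_riemannZeta_le hσ hσ1 (by linarith [hx.1])).trans ?_
        linarith [hx.2]) ht hu
    simpa using this
  have hlow : ∀ u ∈ Icc a (a + r), m / 2 ≤ ‖riemannZeta ((σ : ℂ) + u * I)‖ := by
    intro u hu
    have h2 := hlip u ⟨by linarith [hu.1], by linarith [hu.2]⟩
    have h3 : 100 * T * |u - t| ≤ 1 / 2 := by
      calc 100 * T * |u - t| ≤ 100 * T * r := by gcongr; exact hat u hu
        _ = 1 / 2 := by rw [hr]; field_simp; norm_num
    have h4 := norm_sub_norm_le (riemannZeta ((σ : ℂ) + t * I)) (riemannZeta ((σ : ℂ) + u * I))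
    rw [norm_sub_rev] at h4
    linarith
  have hint : r * (m / 2) ^ (2 * k) ≤ ∫ x in T..(2 * T), ‖riemannZeta ((σ : ℂ) + x * I)‖ ^ (2 * k) := by
    have hi := intervalIntegrable_zeta_pow σ hT0 (2 * k)
    calc r * (m / 2) ^ (2 * k) = ∫ x in a..(a + r), (m / 2) ^ (2 * k) := by simp
      _ ≤ ∫ x in a..(a + r), ‖riemannZeta ((σ : ℂ) + x * I)‖ ^ (2 * k) := by
          refine intervalIntegral.integral_mono_on (by linarith) (by simp) (hi.mono_set ?_)
            fun u hu => ?_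
          · rw [uIcc_of_le (by linarith), uIcc_of_le (by linarith)]
            exact Icc_subset_Icc haT haT2
          · have := hlow u hu
            gcongr
      _ ≤ _ := by
          refine intervalIntegral.integral_mono_interval haT (by linarith) haT2 ?_ hi
          exact Eventually.of_forall fun x => by positivity
  have : zetaMoment σ k T * T = ∫ x in T..(2 * T), ‖riemannZeta ((σ : ℂ) + x * I)‖ ^ (2 * k) := by
    unfold zetaMoment
    rw [one_div, inv_mul_eq_div, div_mul_cancel₀ _ hT0.ne']
  rw [← this] at hint
  calc (m / 2) ^ (2 * k) = 200 * T * (r * (m / 2) ^ (2 * k)) := by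
        rw [hr]; field_simp
    _ ≤ 200 * T * (zetaMoment σ k T * T) := by gcongr
    _ = _ := by ring

/-- Asymptotic moments imply a bound for the maximum of `ζ`. -/
theorem maxLogZeta_isBigO_of_momentAsymptotic {σ δ : ℝ} (hσ : 1 / 2 < σ) (hσ1 : σ < 1) (hδ : 0 < δ)
    (hδσ : δ ≤ σ) (h : MomentAsymptoticUpTo σ (fun T => Real.log T ^ δ)) :
    (fun T : ℝ => maxLogZeta T σ) =O[atTop] (fun T : ℝ => Real.log T ^ (1 - δ)) := by
  obtain ⟨T₀, hT₀⟩ := h (1 / 2) (by norm_num)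
  set A := 16 / (1 - σ) + 4 / (2 * σ - 1) with hA
  have hA0 : 0 < A := by
    have h1 : 0 < 1 - σ := by linarith
    have h2 : 0 < 2 * σ - 1 := by linarith
    positivity
  refine IsBigO.of_bound (12 + A) ?_
  filter_upwards [eventually_ge_atTop T₀, eventually_ge_atTop 200,
    Real.tendsto_log_atTop.eventually_ge_atTop 1] with T hT hT2 hlog
  have hT0 : 0 < T := by linarith
  set l := Real.log T with hl
  have hl0 : 0 < l := by linarith
  have hlδ : 1 ≤ l ^ δ := Real.one_le_rpow hlog hδ.le
  have hl1δ : 1 ≤ l ^ (1 - δ) := Real.one_le_rpow hlog (by linarith)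
  have hσ0 : 0 < σ := by linarith
  rw [Real.norm_eq_abs, Real.norm_of_nonneg (by linarith), abs_le]
  constructor
  -- Lower bound: the first moment is at least 1/2, so the maximum of log |ζ| cannot be as small as
  -- -1.
  · have h1 := (abs_le.mp (hT₀ T hT 1 le_rfl (by simpa using hlδ))).1
    have h2 := one_le_divisorSum hσ hσ1 (le_refl 1)
    have h3 : zetaMoment σ 1 T ≤ Real.exp (maxLogZeta T σ) ^ 2 :=
      zetaMoment_le_exp_maxLogZeta hT0 1
    have h4 : (1 : ℝ) / 2 ≤ Real.exp (maxLogZeta T σ) ^ 2 := by linarith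
    by_contra hcon
    have h5 : maxLogZeta T σ ≤ -1 := by nlinarith
    have h6 : Real.exp (maxLogZeta T σ) ≤ 1 / 2 := by
      calc _ ≤ Real.exp (-1) := Real.exp_le_exp.mpr h5
        _ ≤ 1 / 2 := by
          rw [Real.exp_neg, inv_eq_one_div]
          exact one_div_le_one_div_of_le (by norm_num) (by linarith [Real.exp_one_gt_d9])
    nlinarith [Real.exp_pos (maxLogZeta T σ)]
  · have hB : ∀ t ∈ Icc T (2 * T), Real.log ‖riemannZeta ((σ : ℂ) + t * I)‖ ≤ (12 + A) * l ^ (1 - δ) := by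
      intro t ht
      set m := ‖riemannZeta ((σ : ℂ) + t * I)‖ with hm
      by_cases hm1 : 1 ≤ m
      -- The largest admissible k. Rounding costs at most a factor 2, compensated by the exponent
      -- 2k.
      · set k := ⌊l ^ δ⌋₊ with hk
        have hk1 : 1 ≤ k := Nat.one_le_floor_iff _ |>.mpr hlδ
        have hkl : (k : ℝ) ≤ l ^ δ := Nat.floor_le (by linarith)
        have hkl2 : l ^ δ ≤ 2 * k := by
          have h1 := Nat.lt_floor_add_one (l ^ δ)
          rw [← hk] at h1
          have h2 : (1 : ℝ) ≤ k := by exact_mod_cast hk1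
          linarith
        have hk0 : (0 : ℝ) < k := by exact_mod_cast hk1
        have h1 := (abs_le.mp (hT₀ T hT k hk1 hkl)).2
        have h2 : divisorSum σ k ≤ Real.exp (A * l) := by
          refine (divisorSum_le hσ hσ1 hk1).trans ?_
          rw [Real.exp_le_exp]
          gcongr
          calc (k : ℝ) ^ (1 / σ) ≤ (l ^ δ) ^ (1 / σ) := by gcongr
            _ = l ^ (δ * (1 / σ)) := by rw [← Real.rpow_mul hl0.le]
            _ ≤ l ^ (1 : ℝ) := Real.rpow_le_rpow_of_exponent_le hlog
                (by rw [mul_one_div, div_le_one hσ0]; exact hδσ)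
            _ = l := Real.rpow_one l
        have h3 := pow_le_zetaMoment hσ.le hσ1.le (by linarith) ht hm1 k
        have hTl : T = Real.exp l := (Real.exp_log hT0).symm
        have h4 : (m / 2) ^ (2 * k) ≤ Real.exp ((4 + A) * l) := by
          calc (m / 2) ^ (2 * k) ≤ 200 * T ^ 2 * zetaMoment σ k T := h3
            _ ≤ 200 * T ^ 2 * (2 * Real.exp (A * l)) := by
                have := Real.exp_pos (A * l)
                gcongr; linarith
            -- The constants 200 and 2 are absorbed into powers of T, using T ≥ 200.
            _ ≤ T * T ^ 2 * (T * Real.exp (A * l)) := by gcongr; linarith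
            _ = T ^ 4 * Real.exp (A * l) := by ring
            _ = _ := by
                rw [hTl, ← Real.exp_nat_mul, ← Real.exp_add]; congr 1; push_cast; ring
        have hm0 : 0 < m := by linarith
        have h5 : 2 * k * (Real.log m - Real.log 2) ≤ (4 + A) * l := by
          have := Real.log_le_log (by positivity) h4
          rw [Real.log_exp, Real.log_pow, Real.log_div hm0.ne' two_ne_zero] at this
          push_cast at this
          exact this
        have hlog2 := Real.log_two_lt_d9
        by_cases h6 : Real.log m ≤ 1
        · nlinarith
        · have h7 : l ^ δ * (Real.log m - Real.log 2) ≤ (4 + A) * l := by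
            refine le_trans ?_ h5
            gcongr
            linarith
          have h8 : l = l ^ δ * l ^ (1 - δ) := by
            rw [← Real.rpow_add hl0]; simp
          have h9 : Real.log m - Real.log 2 ≤ (4 + A) * l ^ (1 - δ) := by
            have : l ^ δ * (Real.log m - Real.log 2) ≤ l ^ δ * ((4 + A) * l ^ (1 - δ)) := by
              calc _ ≤ (4 + A) * l := h7
                _ = (4 + A) * (l ^ δ * l ^ (1 - δ)) := by rw [← h8]
                _ = _ := by ring
            exact le_of_mul_le_mul_left this (by linarith)
          nlinarith
      · have : Real.log m ≤ 0 := Real.log_nonpos (norm_nonneg _) (by linarith)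
        exact this.trans (by positivity)
    unfold maxLogZeta
    -- The bound must also be nonnegative, because `sSup` of the empty set is 0.
    apply Real.sSup_le
    · rintro _ ⟨t, ⟨ht, -⟩, rfl⟩
      exact hB t ht
    · positivity

end MaxBound

/-! ### From the maximum to moments -/

section Converse
open Complex

/-- The hypothesis on the maxima of `ζ` bounds powers of `ζ` in a slightly larger window. -/
lemma norm_zeta_pow_le_of_maxLogZeta_le {σ δ C T₀ T η : ℝ} (hδ : 0 < δ) (hδ1 : δ < 1) (hC : 0 ≤ C)
    (h : ∀ T : ℝ, T₀ ≤ T → ∀ β : ℝ, σ - 1 / Real.log (Real.log T) ≤ β →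
        |maxLogZeta T β| ≤ C * Real.log T ^ (1 - δ))
    (hT₀ : T₀ ≤ T / 2) (hT : 0 < T) (hl : 8 ≤ Real.log T) (hL : 1 ≤ Real.log (Real.log T))
    (hη : η = 1 / (2 * Real.log (Real.log T))) (hV : Real.log T ≤ T / 2)
    {k : ℕ} {B : ℝ} (hkB : 2 * C * k * Real.log T ^ (1 - δ) ≤ B) {u v : ℝ} (hu : σ - η ≤ u)
    (hv1 : T - Real.log T ≤ v) (hv2 : v ≤ 2 * T + Real.log T) :
    ‖riemannZeta (u + v * I)‖ ^ k ≤ Real.exp B := by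
  set l := Real.log T with hldef
  -- The enlarged window [T - log T, 2T + log T] is covered by the dyadic intervals starting at T/2,
  -- T and 2T.
  have hmain : ∀ T' : ℝ, T / 2 ≤ T' → T' ≤ 2 * T → v ∈ Icc T' (2 * T') →
      ‖riemannZeta (u + v * I)‖ ^ k ≤ Real.exp B := by
    intro T' h1 h2 hv
    have hT'0 : 0 < T' := by linarith
    have hlog2 := Real.log_two_lt_d9
    have hup : Real.log T' ≤ 2 * l := by
      have := Real.log_le_log hT'0 h2
      rw [Real.log_mul two_ne_zero hT.ne'] at this
      linarith
    have hlow : 7 ≤ Real.log T' := by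
      have := Real.log_le_log (by linarith) h1
      rw [Real.log_div hT.ne' two_ne_zero] at this
      linarith
    have hLup : Real.log (Real.log T') ≤ 2 * Real.log l := by
      have := Real.log_le_log (by linarith) hup
      rw [Real.log_mul two_ne_zero (by linarith)] at this
      linarith
    have hLpos : 0 < Real.log (Real.log T') := Real.log_pos (by linarith)
    -- The 2 in the definition of η allows for log log T' exceeding log log T when T' is as large as
    -- 2T.
    have hβ : σ - 1 / Real.log (Real.log T') ≤ u := by
      have : η ≤ 1 / Real.log (Real.log T') := by
        rw [hη]; exact one_div_le_one_div_of_le hLpos hLup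
      linarith
    have hmax := (le_abs_self _).trans (h T' (hT₀.trans h1) u hβ)
    have hpow : Real.log T' ^ (1 - δ) ≤ 2 * l ^ (1 - δ) := by
      calc Real.log T' ^ (1 - δ) ≤ (2 * l) ^ (1 - δ) :=
            Real.rpow_le_rpow (by linarith) hup (by linarith)
        _ = 2 ^ (1 - δ) * l ^ (1 - δ) := Real.mul_rpow (by norm_num) (by linarith)
        _ ≤ 2 ^ (1 : ℝ) * l ^ (1 - δ) := by
            gcongr
            · norm_num
            · linarith
        _ = _ := by rw [Real.rpow_one]
    calc ‖riemannZeta (u + v * I)‖ ^ k ≤ Real.exp (maxLogZeta T' u) ^ k := by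
          gcongr
          exact norm_zeta_le_exp_maxLogZeta hT'0 hv
      _ = Real.exp (k * maxLogZeta T' u) := (Real.exp_nat_mul _ _).symm
      _ ≤ Real.exp (k * (C * (2 * l ^ (1 - δ)))) := by
          gcongr
          exact hmax.trans (by gcongr)
      _ ≤ Real.exp B := by
          rw [Real.exp_le_exp]; refine le_trans (le_of_eq ?_) hkB; ring
  rcases le_total v T with hvT | hvT
  · exact hmain (T / 2) le_rfl (by linarith) ⟨by linarith, by linarith⟩
  · rcases le_total v (2 * T) with hv2T | hv2T
    · exact hmain T (by linarith) (by linarith) ⟨hvT, hv2T⟩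
    · exact hmain (2 * T) (by linarith) le_rfl ⟨hv2T, by linarith⟩

/-- Growth of `divisorSum` slightly to the left of `σ`, for `k ≤ (log T) ^ σ / log log T`. -/
lemma divisorSum_sub_le {σ l L : ℝ} (hσ : 1 / 2 < σ) (hσ1 : σ < 1) (hl : l = Real.exp L)
    (hL : 1 ≤ L) (hη : 1 / (2 * L) ≤ (σ - 1 / 2) / 2) {k : ℕ} (hk : 1 ≤ k) (hkl : k ≤ l ^ σ / L)
    (hbig : 100 * ((16 / (1 - σ) + 4 / (σ - 1 / 2)) * Real.exp 1) ≤ L ^ (1 / σ - 1)) :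
    divisorSum (σ - 1 / (2 * L)) k ≤ Real.exp (l / L / 100) := by
  set η := 1 / (2 * L) with hηdef
  have hL0 : 0 < L := by linarith
  have hη0 : 0 < η := by positivity
  have hl0 : 0 < l := by rw [hl]; positivity
  set s := σ - η with hs
  have hs1 : 1 / 2 < s := by linarith
  have hs0 : 0 < s := by linarith
  have hσ0 : 0 < σ := by linarith
  set A := 16 / (1 - σ) + 4 / (σ - 1 / 2) with hA
  have hA0 : 0 ≤ A := by
    have h1 : 0 < 1 - σ := by linarith
    have h2 : 0 < σ - 1 / 2 := by linarith
    positivity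
  have hAs : 16 / (1 - s) + 4 / (2 * s - 1) ≤ A := by
    have h1 : 0 < 1 - σ := by linarith
    have h2 : 0 < σ - 1 / 2 := by linarith
    rw [hA]
    exact add_le_add (div_le_div_of_nonneg_left (by norm_num) h1 (by linarith))
      (div_le_div_of_nonneg_left (by norm_num) h2 (by linarith))
  have hk1 : (k : ℝ) ^ (1 / s) ≤ Real.exp 1 * l * L ^ (-(1 / σ)) := by
    calc (k : ℝ) ^ (1 / s) ≤ (l ^ σ / L) ^ (1 / s) := by gcongr
      _ = l ^ (σ * (1 / s)) * L ^ (-(1 / s)) := by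
          rw [Real.div_rpow (by positivity) hL0.le, ← Real.rpow_mul hl0.le, Real.rpow_neg hL0.le,
            div_eq_mul_inv]
      _ ≤ (Real.exp 1 * l) * L ^ (-(1 / σ)) := by
          gcongr
          -- Raising to 1/s instead of 1/σ costs l^{η/s} = exp(Lη/s), at most e because Lη = 1/2 ≤
          -- s.
          · have e : σ * (1 / s) = 1 + η / s := by
              rw [hs] at hs0 ⊢; field_simp; ring
            rw [e, Real.rpow_add hl0, Real.rpow_one, mul_comm]
            gcongr
            rw [hl, ← Real.exp_mul, Real.exp_le_exp, ← mul_div_assoc, div_le_one hs0]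
            have : L * η = 1 / 2 := by rw [hηdef]; field_simp
            linarith
          · linarith
  refine (divisorSum_le hs1 (by linarith) hk).trans ?_
  rw [Real.exp_le_exp]
  calc _ ≤ A * (Real.exp 1 * l * L ^ (-(1 / σ))) := by gcongr
    _ = (100 * (A * Real.exp 1)) * (l * L ^ (-(1 / σ)) / 100) := by ring
    -- As σ < 1, dividing k by L saves more than one power of L; the surplus L^{1/σ-1} swallows
    -- every constant.
    _ ≤ L ^ (1 / σ - 1) * (l * L ^ (-(1 / σ)) / 100) := by gcongr
    _ = l * (L ^ (1 / σ - 1) * L ^ (-(1 / σ))) / 100 := by ring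
    _ = l / L / 100 := by
        rw [← Real.rpow_add hL0, show 1 / σ - 1 + -(1 / σ) = -1 by ring, Real.rpow_neg_one]; ring

/-- For X = exp(l/16) and η = 1/(2L) one gets X^{-η} = exp(-Y/32) with Y = l/L. The factor 4L + 1
coming from 1/η costs exp(Y/100), and 1/32 - 1/100 > 1/50. -/
lemma perronError_le {l L : ℝ} (hL : 1 ≤ L) (hl : 8 ≤ l) (hY : L ≤ l / L)
    (hexp : 5 * (l / L) ≤ Real.exp (1 / 100 * (l / L))) :
    perronError (Real.exp (l / 16)) l (1 / (2 * L)) ≤ Real.exp (-(l / L / 50)) := by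
  have hL0 : 0 < L := by linarith
  set Y := l / L with hYdef
  have hYl : Y ≤ l := div_le_self (by linarith) hL
  have e1 : Real.exp (l / 16) ^ (-(1 / (2 * L))) = Real.exp (-(Y / 32)) := by
    rw [← Real.exp_mul, hYdef]; congr 1; field_simp; norm_num
  have e2 : Real.exp (l / 16) ^ 2 * Real.exp (4 - l ^ 2) ≤ Real.exp (-(Y / 32)) := by
    rw [← Real.exp_nat_mul, ← Real.exp_add, Real.exp_le_exp]
    push_cast
    nlinarith
  unfold perronError
  rw [e1]
  calc _ ≤ 2 * Real.exp (-(Y / 32)) / (1 / (2 * L)) + Real.exp (-(Y / 32)) := by gcongr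
    _ = (4 * L + 1) * Real.exp (-(Y / 32)) := by field_simp; ring
    _ ≤ Real.exp (1 / 100 * Y) * Real.exp (-(Y / 32)) := by
        gcongr
        linarith
    _ ≤ _ := by
        rw [← Real.exp_add, Real.exp_le_exp]
        linarith

/-- The contribution of the tail of the Dirichlet series is negligible. -/
lemma tail_error_le {z Z l L Y N : ℝ} {k : ℕ} (hz : 0 ≤ z) (hzZ : z ≤ Z) (hZ1 : 1 ≤ Z) (hL : 1 ≤ L)
    (hl : 8 ≤ l) (hY : Y = l / L) (hLZ : 32 * Real.log Z ≤ L) (hkY : (k : ℝ) ≤ Y)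
    (hN : Real.exp (l / 4) / 2 ≤ N) :
    z ^ k / N * Real.exp (l / 16) ^ 2 * Real.exp 4 ≤
      2 * Real.exp 4 * Real.exp (-(Y / 100)) := by
  have hL0 : 0 < L := by linarith
  have hYl : Y ≤ l := hY ▸ div_le_self (by linarith) hL
  have h2 : z ^ k ≤ Real.exp (l / 32) := by
    calc _ ≤ Z ^ k := by gcongr
      _ = Real.exp (k * Real.log Z) := by
          rw [Real.exp_nat_mul, Real.exp_log (by linarith)]
      _ ≤ Real.exp (Y * (L / 32)) := by
          have := Real.log_nonneg hZ1
          rw [Real.exp_le_exp]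
          exact mul_le_mul hkY (by linarith) this (by rw [hY]; positivity)
      _ = Real.exp (l / 32) := by rw [hY]; congr 1; field_simp
  calc _ ≤ Real.exp (l / 32) / (Real.exp (l / 4) / 2) * Real.exp (l / 16) ^ 2 * Real.exp 4 := by
        gcongr
    _ = 2 * Real.exp 4 * (Real.exp (l / 32) * (Real.exp (l / 4))⁻¹ * Real.exp (l / 16) ^ 2) := by
        rw [div_div_eq_mul_div, div_eq_mul_inv]; ring
    -- The total exponent is l(1/32 - 1/4 + 1/8) = -3l/32, and Y ≤ l.
    _ ≤ 2 * Real.exp 4 * Real.exp (-(Y / 100)) := by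
        gcongr
        rw [← Real.exp_neg, ← Real.exp_nat_mul, ← Real.exp_add, ← Real.exp_add, Real.exp_le_exp]
        push_cast; linarith

/-- The contribution of the diagonal error is negligible. -/
lemma diagonal_error_le {τ S l L Y N : ℝ} (hτ0 : 0 ≤ τ) (hτ : τ ≤ Real.exp (-(Y / 50)))
    (hS0 : 0 ≤ S) (hS : S ≤ Real.exp (Y / 100)) (hL : 1 ≤ L) (hY : Y = l / L) (hY0 : 0 ≤ Y)
    (hN : Real.exp (l / 8) ≤ N) :
    (2 * τ + τ ^ 2 + N ^ (-(2 * (1 / (2 * L))))) * S ≤ 4 * Real.exp (-(Y / 100)) := by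
  have hL0 : 0 < L := by linarith
  have hη : 0 ≤ 1 / (2 * L) := by positivity
  have h2 : N ^ (-(2 * (1 / (2 * L)))) ≤ Real.exp (-(Y / 50)) := by
    calc N ^ (-(2 * (1 / (2 * L)))) ≤ Real.exp (l / 8) ^ (-(2 * (1 / (2 * L)))) :=
          Real.rpow_le_rpow_of_nonpos (Real.exp_pos _) hN (by linarith)
      _ = Real.exp (-(Y / 8)) := by
          rw [← Real.exp_mul, hY]; congr 1; field_simp
      _ ≤ _ := by rw [Real.exp_le_exp]; linarith
  have h3 : Real.exp (-(Y / 50)) ≤ 1 := by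
    rw [Real.exp_le_one_iff]; linarith
  have h4 : 2 * τ + τ ^ 2 + N ^ (-(2 * (1 / (2 * L)))) ≤ 4 * Real.exp (-(Y / 50)) := by nlinarith
  calc _ ≤ 4 * Real.exp (-(Y / 50)) * Real.exp (Y / 100) := by gcongr
    _ = 4 * Real.exp (-(Y / 100)) := by rw [mul_assoc, ← Real.exp_add]; congr 2; ring

/-- The range of `k` in terms of `log T` and `log log T`. -/
lemma exponent_range_bounds {σ δ C κ l L : ℝ} (hδ1 : δ ≤ 1) (hδσ : δ ≤ σ) (hC : 1 ≤ C)
    (hl : 1 ≤ l) (hL : 0 < L) (hκ : κ ≤ 1 / (200 * C) * l ^ δ / L) :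
    κ ≤ l ^ σ / L ∧ κ ≤ l / L ∧ 2 * C * κ * l ^ (1 - δ) ≤ l / L / 100 := by
  have hC0 : 0 < C := by linarith
  have hl0 : 0 < l := by linarith
  have hlδ1 : l ^ δ * l ^ (1 - δ) = l := by
    rw [← Real.rpow_add hl0]; simp
  have hkδ : κ ≤ l ^ δ / L := by
    refine hκ.trans (div_le_div_of_nonneg_right (mul_le_of_le_one_left (by positivity) ?_) hL.le)
    rw [div_le_one (by positivity)]; linarith
  refine ⟨?_, ?_, ?_⟩
  · exact hkδ.trans (div_le_div_of_nonneg_right (Real.rpow_le_rpow_of_exponent_le hl hδσ) hL.le)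
  · refine hkδ.trans (div_le_div_of_nonneg_right ?_ hL.le)
    calc l ^ δ ≤ l ^ (1 : ℝ) := Real.rpow_le_rpow_of_exponent_le hl hδ1
      _ = l := Real.rpow_one l
  -- The constant 200C is fixed here: 2C/(200C) = 1/100 is the exponent allowed for |ζ|^k.
  · calc 2 * C * κ * l ^ (1 - δ) ≤ 2 * C * (1 / (200 * C) * l ^ δ / L) * l ^ (1 - δ) := by gcongr
      _ = (l ^ δ * l ^ (1 - δ)) / L / 100 := by field_simp; norm_num
      _ = l / L / 100 := by rw [hlδ1]

/-- The moment asymptotic for `T` large in terms of explicit inequalities. -/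
lemma abs_zetaMoment_sub_divisorSum_le_of_large {σ δ C T₀ T l L ε : ℝ} {k : ℕ} (hσ : 1 / 2 < σ)
    (hσ1 : σ < 1) (hδ : 0 < δ) (hδσ : δ ≤ σ) (hC : 1 ≤ C)
    (h : ∀ T : ℝ, T₀ ≤ T → ∀ β : ℝ, σ - 1 / Real.log (Real.log T) ≤ β →
        |maxLogZeta T β| ≤ C * Real.log T ^ (1 - δ))
    (hl : l = Real.log T) (hL : L = Real.log l) (hl8 : 8 ≤ l) (hL1 : 1 ≤ L)
    (hLZ : 32 * Real.log (max ‖riemannZeta ((1 + σ : ℝ) : ℂ)‖ 1) ≤ L) (hLY : L ≤ l / L)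
    (hYexp : 5 * (l / L) ≤ Real.exp (1 / 100 * (l / L)))
    (hsmall : (5 + 2 * Real.exp 4) * Real.exp (-(l / L / 100)) ≤ ε) (hε1 : ε ≤ 1)
    (hVT : l ≤ T / 2)
    (hbig : 100 * ((16 / (1 - σ) + 4 / (σ - 1 / 2)) * Real.exp 1) ≤ L ^ (1 / σ - 1))
    (hηs : 1 / (2 * L) ≤ (σ - 1 / 2) / 2) (hTT : 2 * T₀ ≤ T) (hT0 : 0 < T) (hk : 1 ≤ k)
    (hkle : (k : ℝ) ≤ 1 / (200 * C) * l ^ δ / L) :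
    |zetaMoment σ k T - divisorSum σ k| ≤ 9 * ε * divisorSum σ k := by
  have hTl : T = Real.exp l := by rw [hl, Real.exp_log hT0]
  have hL0 : 0 < L := by linarith
  have hl0 : 0 < l := by linarith
  have hlL : l = Real.exp L := by rw [hL, Real.exp_log hl0]
  obtain ⟨hkσ, hkY, hkB⟩ :=
    exponent_range_bounds (by linarith) hδσ hC (by linarith) hL0 hkle
  obtain ⟨Y, hY⟩ : ∃ Y, Y = l / L := ⟨_, rfl⟩
  rw [← hY] at hkY hkB hsmall
  have hY0 : 0 < Y := hY ▸ div_pos hl0 hL0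
  have hYl : Y ≤ l := hY ▸ div_le_self hl0.le hL1
  have hη0 : 0 < 1 / (2 * L) := by positivity
  have hη1 : 1 / (2 * L) ≤ 1 := by
    rw [div_le_one (by positivity)]; linarith
  -- The length N ≈ T^{1/4} lies between two needs: it must exceed X² = T^{1/8} to make the tail
  -- small, and N² must be small against T for the mean value theorem.
  obtain ⟨N, hN⟩ : ∃ N : ℕ, N = ⌊Real.exp (l / 4)⌋₊ := ⟨_, rfl⟩
  have hNle : (N : ℝ) ≤ Real.exp (l / 4) := hN ▸ Nat.floor_le (Real.exp_pos _).le
  have hNge : Real.exp (l / 4) / 2 ≤ N := by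
    have h1 := Nat.lt_floor_add_one (Real.exp (l / 4))
    have h2 := Real.add_one_le_exp (l / 4)
    rw [← hN] at h1
    linarith
  have hexp1 : 2 ≤ Real.exp (l / 8) := by
    have := Real.add_one_le_exp (l / 8); linarith
  have hNX : Real.exp (l / 8) ≤ N := by
    refine le_trans ?_ hNge
    rw [show l / 4 = l / 8 + l / 8 by ring, Real.exp_add]
    nlinarith
  have hN1 : 1 ≤ N := by
    have : (1 : ℝ) ≤ N := by linarith
    exact_mod_cast this
  have hτle : perronError (Real.exp (l / 16)) l (1 / (2 * L)) ≤ Real.exp (-(Y / 50)) :=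
    hY ▸ perronError_le hL1 hl8 hLY hYexp
  have hτ0 : 0 ≤ perronError (Real.exp (l / 16)) l (1 / (2 * L)) := by
    unfold perronError; positivity
  have hE0 : 0 < Real.exp (-(Y / 100)) := Real.exp_pos _
  have he4 : 0 < Real.exp 4 := Real.exp_pos 4
  have hKE : ∀ c : ℝ, c ≤ 5 + 2 * Real.exp 4 → c * Real.exp (-(Y / 100)) ≤ ε := fun c hc =>
    (mul_le_mul_of_nonneg_right hc hE0.le).trans hsmall
  refine abs_zetaMoment_sub_divisorSum_le (X := Real.exp (l / 16)) (V := l) (η := 1 / (2 * L))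
    (M := Real.exp (Y / 100)) (N := N) hk
    (Real.one_le_exp (by linarith)) (by linarith) hη0 hη1 hN1 (by linarith) hσ1 (by linarith)
    hε1 (fun u v hu hv1 hv2 => ?_) ?_ ?_ ?_
  · subst hL hl
    exact norm_zeta_pow_le_of_maxLogZeta_le hδ (by linarith) (by linarith) h (by linarith) hT0 hl8
      hL1 rfl hVT hkB hu hv1 hv2
  · refine le_trans ?_ (hKE (1 + 2 * Real.exp 4) (by linarith))
    rw [add_mul, one_mul]
    refine add_le_add ?_ (tail_error_le (norm_nonneg _) (le_max_left _ 1) (le_max_right _ 1)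
      hL1 hl8 hY hLZ hkY hNge)
    calc _ ≤ Real.exp (Y / 100) * Real.exp (-(Y / 50)) := by gcongr
      _ = _ := by rw [← Real.exp_add]; congr 1; ring
  · refine le_trans (diagonal_error_le hτ0 hτle ?_ ?_ hL1 hY hY0.le hNX) (hKE 4 (by linarith))
    · exact zero_le_one.trans (one_le_divisorSum (by linarith) (by linarith) hk)
    · rw [hY]; exact divisorSum_sub_le hσ hσ1 hlL hL1 hηs hk hkσ hbig
  · refine le_trans ?_ (hKE 2 (by linarith))
    calc 2 * (N : ℝ) ^ 2 / T ≤ 2 * Real.exp (l / 4) ^ 2 / Real.exp l := by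
          rw [← hTl]; gcongr
      _ = 2 * Real.exp (-(l / 2)) := by
          rw [mul_div_assoc, ← Real.exp_nat_mul, ← Real.exp_sub]
          congr 2; push_cast; ring
      _ ≤ _ := by gcongr; linarith

/-- A bound for the maxima of `ζ` implies asymptotic moments. -/
theorem momentAsymptotic_of_maxLogZeta_le {σ δ C T₀ : ℝ} (hσ : 1 / 2 < σ) (hσ1 : σ < 1) (hδ : 0 < δ)
    (hδσ : δ ≤ σ) (hC : 1 ≤ C)
    (h : ∀ T : ℝ, T₀ ≤ T → ∀ β : ℝ, σ - 1 / Real.log (Real.log T) ≤ β →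
        |maxLogZeta T β| ≤ C * Real.log T ^ (1 - δ)) :
    MomentAsymptoticUpTo σ
      (fun T => 1 / (200 * C) * Real.log T ^ δ / Real.log (Real.log T)) := by
  intro ε hε
  set ε₀ := min (ε / 9) 1 with hε₀
  have hε₀pos : 0 < ε₀ := by positivity
  set Z := max ‖riemannZeta ((1 + σ : ℝ) : ℂ)‖ 1 with hZ
  have hZ1 : 1 ≤ Z := le_max_right _ _
  set K := 5 + 2 * Real.exp 4 with hK
  have hl := Real.tendsto_log_atTop
  have hL : Tendsto (fun T => Real.log (Real.log T)) atTop atTop := hl.comp hl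
  have hY : Tendsto (fun T => Real.log T / Real.log (Real.log T)) atTop atTop := by
    have h1 : Tendsto (fun x : ℝ => x / Real.log x) atTop atTop := by
      have h2 : Tendsto (fun y : ℝ => Real.exp y / y) atTop atTop := by
        simpa using Real.tendsto_exp_div_pow_atTop 1
      refine (h2.comp Real.tendsto_log_atTop).congr' ?_
      filter_upwards [eventually_gt_atTop 0] with x hx
      simp [Real.exp_log hx]
    exact h1.comp hl
  have hLY : ∀ᶠ T in atTop, Real.log (Real.log T) ≤ Real.log T / Real.log (Real.log T) := by
    have h1 : ∀ᶠ y : ℝ in atTop, y ≤ Real.exp y / y := by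
      have h2 := (Real.tendsto_exp_div_pow_atTop 2).eventually_ge_atTop 1
      filter_upwards [h2, eventually_gt_atTop 0] with y hy hy0
      rw [le_div_iff₀ (by positivity)] at hy ⊢
      linarith
    filter_upwards [hL.eventually h1, hl.eventually_gt_atTop 0] with T hT hT0
    rwa [Real.exp_log hT0] at hT
  have hYexp : ∀ᶠ T in atTop, 5 * (Real.log T / Real.log (Real.log T)) ≤
      Real.exp (1 / 100 * (Real.log T / Real.log (Real.log T))) := by
    have h1 : ∀ᶠ y : ℝ in atTop, 5 * y ≤ Real.exp (1 / 100 * y) := by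
      have h2 := (isLittleO_pow_exp_pos_mul_atTop 1 (b := 1 / 100) (by norm_num)).bound
        (c := 1 / 5) (by norm_num)
      filter_upwards [h2, eventually_ge_atTop 0] with y hy hy0
      rw [pow_one, Real.norm_of_nonneg hy0, Real.norm_of_nonneg (Real.exp_pos _).le] at hy
      linarith
    exact hY.eventually h1
  have hsmall : ∀ᶠ T in atTop, K * Real.exp (-(Real.log T / Real.log (Real.log T) / 100)) ≤ ε₀ := by
    have h1 : Tendsto (fun y : ℝ => K * Real.exp (-(y / 100))) atTop (𝓝 (K * 0)) := by
      refine Tendsto.const_mul K (Real.tendsto_exp_neg_atTop_nhds_zero.comp ?_)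
      exact tendsto_id.atTop_div_const (by norm_num)
    rw [mul_zero] at h1
    exact hY.eventually (h1.eventually_le_const hε₀pos)
  have hVT : ∀ᶠ T : ℝ in atTop, Real.log T ≤ T / 2 := by
    have := Real.isLittleO_log_id_atTop.bound (c := 1 / 2) (by norm_num)
    filter_upwards [this, eventually_ge_atTop 1] with T hT hT1
    rw [Real.norm_of_nonneg (Real.log_nonneg hT1), id, Real.norm_of_nonneg (by linarith)] at hT
    linarith
  have hbig : ∀ᶠ T : ℝ in atTop, 100 * ((16 / (1 - σ) + 4 / (σ - 1 / 2)) * Real.exp 1) ≤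
      Real.log (Real.log T) ^ (1 / σ - 1) := by
    have : 0 < 1 / σ - 1 := by
      rw [sub_pos, lt_div_iff₀ (by linarith)]; linarith
    exact ((tendsto_rpow_atTop this).comp hL).eventually_ge_atTop _
  have hηs : ∀ᶠ T : ℝ in atTop, 1 / (2 * Real.log (Real.log T)) ≤ (σ - 1 / 2) / 2 := by
    have h0 : 0 < σ - 1 / 2 := by linarith
    filter_upwards [hL.eventually_ge_atTop (1 / (σ - 1 / 2))] with T hT
    have hpos : 0 < Real.log (Real.log T) := lt_of_lt_of_le (by positivity) hT
    rw [div_le_iff₀ h0] at hT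
    rw [div_le_iff₀ (by linarith)]
    linarith
  have hev : ∀ᶠ T : ℝ in atTop, ∀ k : ℕ, 1 ≤ k →
      (k : ℝ) ≤ 1 / (200 * C) * Real.log T ^ δ / Real.log (Real.log T) →
      |zetaMoment σ k T - divisorSum σ k| ≤ ε * divisorSum σ k := by
    filter_upwards [hl.eventually_ge_atTop 8, hL.eventually_ge_atTop 1,
      hL.eventually_ge_atTop (32 * Real.log Z), hLY, hYexp, hsmall, hVT, hbig, hηs,
      eventually_ge_atTop (2 * T₀), eventually_gt_atTop 0] with T hl8 hL1 hLZ hLY hYexp hsmall hVT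
      hbig hηs hTT hT0 k hk hkle
    refine (abs_zetaMoment_sub_divisorSum_le_of_large hσ hσ1 hδ hδσ hC h rfl rfl hl8 hL1 hLZ hLY
      hYexp hsmall (min_le_right _ _) hVT hbig hηs hTT hT0 hk hkle).trans
      (mul_le_mul_of_nonneg_right ?_ ?_)
    · have := min_le_left (ε / 9) 1
      linarith
    · have := one_le_divisorSum hσ hσ1 hk
      linarith
  obtain ⟨T₁, hT₁⟩ := eventually_atTop.mp hev
  exact ⟨T₁, hT₁⟩

end Converse

theorem theorem1p4 (σ δ : ℝ) (hσ : 1 / 2 < σ) (hσ1 : σ < 1) (hδ : 0 < δ) (hδσ : δ ≤ σ) :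
    (MomentAsymptoticUpTo σ (fun T => Real.log T ^ δ) →
      (fun T : ℝ => maxLogZeta T σ) =O[atTop] (fun T : ℝ => Real.log T ^ (1 - δ))) ∧
    ((∃ C T₀ : ℝ, ∀ T : ℝ, T₀ ≤ T → ∀ β : ℝ, σ - 1 / Real.log (Real.log T) ≤ β →
        |maxLogZeta T β| ≤ C * Real.log T ^ (1 - δ)) →
      ∃ c : ℝ, 0 < c ∧
        MomentAsymptoticUpTo σ (fun T => c * Real.log T ^ δ / Real.log (Real.log T))) := by
  refine ⟨maxLogZeta_isBigO_of_momentAsymptotic hσ hσ1 hδ hδσ, ?_⟩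
  rintro ⟨C, T₀, h⟩
  have hC : 1 ≤ max C 1 := le_max_right _ _
  -- Raising C and T₀ to at least 1 makes log T nonnegative, so that enlarging C weakens the
  -- hypothesis.
  refine ⟨1 / (200 * max C 1), by positivity,
    momentAsymptotic_of_maxLogZeta_le (T₀ := max T₀ 1) hσ hσ1 hδ hδσ hC fun T hT β hβ => ?_⟩
  refine (h T ((le_max_left _ _).trans hT) β hβ).trans ?_
  have : 0 ≤ Real.log T := Real.log_nonneg ((le_max_right _ _).trans hT)
  gcongr
  exact le_max_left _ _
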